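/- Let $\Omega\subset\mathbb{R}^n$ be a bounded open set, let $1<p\le q\le n$, and let $\mu$ be a nonnegative bounded Radon measure on $\Omega$. Every local renormalized solution $u$ of $$-\operatorname{div}\left(|\nabla u|^{p-2}\nabla u+|\nabla u|^{q-2}\nabla u\right)=\mu\quad\text{in }\Omega$$ is locally essentially bounded below: for every compact $K\subset\Omega$ there is $c\in\mathbb{R}$ with $u\ge c$ almost everywhere in $K$. Here, for $K\subset\Omega$ compact, $\operatorname{cap}_q(K,\Omega)=\inf\{\int_\Omega|\nabla\varphi|^q\,dx:\varphi\in C_0^\infty(\Omega),\ \varphi\ge1\text{ on }K\}$; for $U\subset\Omega$ open, $\operatorname{cap}_q(U,\Omega)$ is the supremum of $\operatorname{cap}_q(K,\Omega)$ over compact $K\subset U$; for arbitrary $A\subset\Omega$, $\operatorname{cap}_q(A,\Omega)$ is the infimum of $\operatorname{cap}_q(U,\Omega)$ over open $U$ with $A\subset U\subset\Omega$. A function $w$ is $q$-quasicontinuous if for every $\varepsilon>0$ there is an open $U\subset\Omega$ with $\operatorname{cap}_q(U,\Omega)<\varepsilon$ such that $w$ is continuous on $\Omega\setminus U$. Write $\mu=\mu_0+\mu_s$,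 where $\mu_0,\mu_s\ge0$, $\mu_0$ does not charge sets of $q$-capacity zero, and $\mu_s$ is concentrated on a set of $q$-capacity zero. For $k>0$ let $T_k(s)=\max\{-k,\min\{k,s\}\}$. A measurable $u:\Omega\to[-\infty,\infty]$ is a local renormalized solution if 1. $T_k(u)\in W^{1,q}_{\rm loc}(\Omega)$ for all $k>0$; 2. $|u|^{q-1}\in L^m_{\rm loc}(\Omega)$ for all $1\le m<\frac{n}{n-q}$ (for all $1\le m<\infty$ if $q=n$); 3. for every bounded Lipschitz function $h:\mathbb{R}\to\mathbb{R}$ such that $h'$ has compact support, and every $\phi\in C_0^\infty(\Omega)$, the integrals on the left-hand side below converge absolutely, and $$\int_\Omega(|\nabla u|^p+|\nabla u|^q)h'(u)\phi\,dx+\int_\Omega(|\nabla u|^{p-2}\nabla u+|\nabla u|^{q-2}\nabla u)\cdot\nabla\phi\,h(u)\,dx=\int_\Omega h(u)\phi\,d\mu_0+h(+\infty)\int_\Omega\phi\,d\mu_s .$$ In 3, $\nabla u$ is the generalized gradient, that is, the measurable function with $\nabla T_k(u)=\chi_{\{|u|<k\}}\nabla u$ a.e. for every $k>0$; in the integral with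 respect to $\mu_0$, $u$ stands for its $q$-quasicontinuous representative; and $h(\pm\infty)=\lim_{t\to\pm\infty}h(t)$. -/

import Mathlib

open MeasureTheory Filter Topology
open scoped ENNReal ContDiff

noncomputable section

namespace PQGrowth

/-- The Euclidean space `ℝⁿ`. -/
abbrev E (n : ℕ) : Type := EuclideanSpace ℝ (Fin n)

variable {n : ℕ}

/-- Test functions: `φ ∈ C₀^∞(Ω)`. -/
structure IsTest (Ω : Set (E n)) (φ : E n → ℝ) : Prop where
  smooth : ContDiff ℝ ∞ φ
  compact : HasCompactSupport φ
  support : tsupport φ ⊆ Ω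

/-- `f ∈ L^s_loc(Ω)`. -/
def MemLpLoc {F : Type*} [NormedAddCommGroup F] (s : ℝ) (Ω : Set (E n)) (f : E n → F) : Prop :=
  ∀ K : Set (E n), IsCompact K → K ⊆ Ω → MemLp f (ENNReal.ofReal s) (volume.restrict K)

/-- The locally integrable field `F` is the weak (distributional) gradient of the locally
integrable function `f` in `Ω`. -/
structure IsWeakGradient (Ω : Set (E n)) (f : E n → ℝ) (F : E n → E n) : Prop where
  locInt_fun : MemLpLoc 1 Ω f
  locInt_grad : MemLpLoc 1 Ω F
  integral_eq : ∀ φ : E n → ℝ, IsTest Ω φ →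
    ∫ x in Ω, f x • gradient φ x = - ∫ x in Ω, φ x • F x

/-- `f ∈ W^{1,q}_loc(Ω)`. -/
def MemSobolevLoc (q : ℝ) (Ω : Set (E n)) (f : E n → ℝ) : Prop :=
  MemLpLoc q Ω f ∧ ∃ F : E n → E n, IsWeakGradient Ω f F ∧ MemLpLoc q Ω F

/-- `cap_q(K, Ω) = inf {∫_Ω |∇φ|^q : φ ∈ C₀^∞(Ω), φ ≥ 1 on K}`, for compact `K ⊆ Ω`. -/
def capCompact (q : ℝ) (Ω K : Set (E n)) : ℝ≥0∞ :=
  ⨅ (φ : E n → ℝ) (_ : IsTest Ω φ) (_ : ∀ x ∈ K, 1 ≤ φ x), ∫⁻ x in Ω, ‖gradient φ x‖ₑ ^ q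

/-- `cap_q(U, Ω)` for open `U ⊆ Ω`: the supremum over the compact subsets of `U`. -/
def capOpen (q : ℝ) (Ω U : Set (E n)) : ℝ≥0∞ :=
  ⨆ (K : Set (E n)) (_ : IsCompact K) (_ : K ⊆ U), capCompact q Ω K

/-- The `q`-capacity `cap_q(A, Ω)` of an arbitrary `A ⊆ Ω`: the infimum over the open sets
between `A` and `Ω`. -/
def cap (q : ℝ) (Ω A : Set (E n)) : ℝ≥0∞ :=
  ⨅ (U : Set (E n)) (_ : IsOpen U) (_ : A ⊆ U) (_ : U ⊆ Ω), capOpen q Ω U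

/-- `w : Ω → [-∞, ∞]` is `q`-quasicontinuous. -/
def IsQuasicontinuous (q : ℝ) (Ω : Set (E n)) (w : E n → EReal) : Prop :=
  ∀ ε : ℝ≥0∞, 0 < ε → ∃ U : Set (E n), IsOpen U ∧ U ⊆ Ω ∧ cap q Ω U < ε ∧ ContinuousOn w (Ω \ U)

/-- `μ₀ + μₛ` is the decomposition of `μ` on `Ω` into a part that does not charge sets of
`q`-capacity zero and a part that is concentrated on a set of `q`-capacity zero. For a finite
measure it exists and is unique. -/
structure IsCapDecomposition (q : ℝ) (Ω : Set (E n)) (μ μ₀ μₛ : Measure (E n)) : Prop where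
  sum_eq : μ.restrict Ω = μ₀ + μₛ
  diffuse : ∀ A : Set (E n), A ⊆ Ω → cap q Ω A = 0 → μ₀ A = 0
  singular : ∃ A : Set (E n), A ⊆ Ω ∧ cap q Ω A = 0 ∧ μₛ (Ω \ A) = 0

/-- The truncation `T_k(s) = max {-k, min {k, s}}` of an extended real number. -/
def trunc (k : ℝ) (s : EReal) : ℝ :=
  (max ((-k : ℝ) : EReal) (min (k : EReal) s)).toReal

/-- The generalized gradient `Z = ∇u` of a function `u` all of whose truncations are weakly
differentiable: `∇ T_k(u) = χ_{|u| < k} Z` for every `k > 0`. It is unique a.e. in `{|u| < ∞}`. -/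
def IsGeneralizedGradient (Ω : Set (E n)) (u : E n → EReal) (Z : E n → E n) : Prop :=
  AEMeasurable Z (volume.restrict Ω) ∧
  ∀ k : ℝ, 0 < k →
    IsWeakGradient Ω (fun x => trunc k (u x)) ({x | (u x).abs < ENNReal.ofReal k}.indicator Z)

/-- The vector field `|ξ|^{p-2} ξ + |ξ|^{q-2} ξ` (equal to `0` at `ξ = 0`). -/
def flux (p q : ℝ) (ξ : E n) : E n :=
  ‖ξ‖ ^ (p - 2) • ξ + ‖ξ‖ ^ (q - 2) • ξ

/-- `h ∈ W^{1,∞}(ℝ)`, that is, `h` is bounded and Lipschitz, and `h'` has compact support. -/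
structure IsRenormalizer (h : ℝ → ℝ) : Prop where
  bounded : ∃ C : ℝ, ∀ t, |h t| ≤ C
  lipschitz : ∃ L : NNReal, LipschitzWith L h
  compact_deriv : HasCompactSupport (deriv h)

/-- The value `h(s)` for `s ∈ [-∞, ∞]`, with `h(±∞) = lim_{t → ±∞} h(t)`. It is used only for
functions that are constant near `+∞` and near `-∞`, so the limits exist. -/
def ext (h : ℝ → ℝ) (s : EReal) : ℝ :=
  if s = ⊤ then limUnder atTop h else if s = ⊥ then limUnder atBot h else h s.toReal

/-- The renormalized equation in `Ω`, for the generalized gradient `Z = ∇u` and with `w` the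
quasicontinuous representative of `u`: for all `h` and `φ`, the integrals on the left exist and
`∫ (|∇u|^p + |∇u|^q) h'(u) φ dx + ∫ (|∇u|^{p-2} ∇u + |∇u|^{q-2} ∇u) · ∇φ h(u) dx
  = ∫ h(w) φ dμ₀ + h(+∞) ∫ φ dμₛ`. -/
def RenormalizedEquation (p q : ℝ) (Ω : Set (E n)) (μ₀ μₛ : Measure (E n))
    (u w : E n → EReal) (Z : E n → E n) : Prop :=
  ∀ h : ℝ → ℝ, IsRenormalizer h → ∀ φ : E n → ℝ, IsTest Ω φ →
    IntegrableOn (fun x => (‖Z x‖ ^ p + ‖Z x‖ ^ q) * ext (deriv h) (u x) * φ x) Ω ∧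
    IntegrableOn (fun x => inner ℝ (flux p q (Z x)) (gradient φ x) * ext h (u x)) Ω ∧
    (∫ x in Ω, (‖Z x‖ ^ p + ‖Z x‖ ^ q) * ext (deriv h) (u x) * φ x) +
        (∫ x in Ω, inner ℝ (flux p q (Z x)) (gradient φ x) * ext h (u x)) =
      (∫ x in Ω, ext h (w x) * φ x ∂μ₀) + ext h ⊤ * ∫ x in Ω, φ x ∂μₛ

/-- `u : Ω → [-∞, ∞]` is a local renormalized solution of
`-div (|∇u|^{p-2} ∇u + |∇u|^{q-2} ∇u) = μ` in `Ω ⊆ ℝⁿ`. Only `u` and `μ` on `Ω` matter. The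
integrability condition `m < n / (n - q)` is written as `m (n - q) < n`, so that it imposes no
upper bound on `m` when `q = n`. -/
structure IsLocalRenormalizedSolution (p q : ℝ) (Ω : Set (E n)) (μ : Measure (E n))
    (u : E n → EReal) : Prop where
  measurable : AEMeasurable u (volume.restrict Ω)
  trunc_mem : ∀ k : ℝ, 0 < k → MemSobolevLoc q Ω (fun x => trunc k (u x))
  integrable : ∀ m : ℝ, 1 ≤ m → m * ((n : ℝ) - q) < n →
    ∀ K : Set (E n), IsCompact K → K ⊆ Ω → ∫⁻ x in K, ((u x).abs ^ (q - 1)) ^ m < ⊤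
  equation : ∃ (Z : E n → E n) (w : E n → EReal) (μ₀ μₛ : Measure (E n)),
    IsGeneralizedGradient Ω u Z ∧
    IsQuasicontinuous q Ω w ∧ (∀ᵐ x ∂(volume.restrict Ω), w x = u x) ∧
    IsCapDecomposition q Ω μ μ₀ μₛ ∧
    RenormalizedEquation p q Ω μ₀ μₛ u w Z

/-- `u` is locally essentially bounded below in `Ω`. -/
def LocallyEssBoundedBelow (Ω : Set (E n)) (u : E n → EReal) : Prop :=
  ∀ K : Set (E n), IsCompact K → K ⊆ Ω →
    ∃ c : ℝ, ∀ᵐ x ∂(volume.restrict K), (c : EReal) ≤ u x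

end PQGrowth

end

open MeasureTheory Filter Topology
open scoped ENNReal ContDiff

noncomputable section

namespace PQGrowth

variable {n : ℕ}

/-! The measure enters only through its sign: for nonnegative h and φ the right-hand side of the
renormalized equation is nonnegative, so u, which is finite a.e., is a supersolution in the sense of
`IsRealSupersolution`. The rest is a De Giorgi iteration on the superlevel sets of -u, at an
exponent so low that the integrability of a power of |u| slightly above q - 1 suffices to start it.

Put y = -u/d - m with d ≥ 1 and σ = (1 + ε)(q - 1). Testing with φ = η^n and h = 1 - (1 + y₊)^{-ε},
truncated in y, gives `IsRealSupersolution.caccioppoli`: the integral of (|∇u|/d)^q (1 + y)^{-1-ε}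
η^n over {y > 0} is controlled by that of (1 + y)^σ over {y > 0, η > 0}. The equation is not
homogeneous, but the p-term has a good sign on the left and is absorbed on the right by a Young
inequality valid for p ≤ q and d ≥ 1, so the constant depends neither on d nor on m.

The Sobolev inequality for W^{1,1} is then applied to η^n times a C¹ function of y that grows like
y^{σ(n-1)/n}; its n/(n-1)-th power is comparable to y^σ again. This gives the superlinear estimate
`IsRealSupersolution.excess_le` for the integral of (-u/d - t)₊^σ over {ψ > t}. The single parameter
t raises the level of -u/d and shrinks the domain simultaneously.

Along t = 1 - 2^{-j} the excess tends to 0 as soon as it is small for t = 0. There it is at most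
d^{-σ} ∫ |u|^σ over the support of ψ, which is small for large d. The limit says u ≥ -d a.e. where ψ
≥ 1. -/

/-! ### Mollification and the Sobolev inequality for compositions with weakly differentiable
functions -/

open ContinuousLinearMap in
/-- The derivative of a mollification is the mollification of the weak gradient. -/
theorem IsWeakGradient.fderiv_convolution {Ω : Set (E n)} {f : E n → ℝ} {F : E n → E n}
    (hw : IsWeakGradient Ω f F) {K : Set (E n)} (hK : IsCompact K) (hKΩ : K ⊆ Ω)
    {ρ : E n → ℝ} (hρ : ContDiff ℝ ∞ ρ) {r : ℝ} (hr : tsupport ρ ⊆ Metric.closedBall 0 r)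
    {x : E n} (hx : Metric.closedBall x r ⊆ K) :
    fderiv ℝ (convolution ρ (K.indicator f) (lsmul ℝ ℝ) volume) x =
      innerSL ℝ (convolution ρ (K.indicator F) (lsmul ℝ ℝ) volume x) := by
  have hKm : MeasurableSet K := hK.measurableSet
  have hf : Integrable (K.indicator f) := by
    rw [integrable_indicator_iff hKm]
    have := hw.locInt_fun K hK hKΩ
    rw [ENNReal.ofReal_one, memLp_one_iff_integrable] at this
    exact this
  have hF : Integrable (K.indicator F) := by
    rw [integrable_indicator_iff hKm]
    have := hw.locInt_grad K hK hKΩ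
    rw [ENNReal.ofReal_one, memLp_one_iff_integrable] at this
    exact this
  have hcρ : HasCompactSupport ρ := (isCompact_closedBall 0 r).of_isClosed_subset
    (isClosed_tsupport ρ) hr
  -- The weak gradient is tested with the reflected kernel; the sign from differentiating t ↦ x - t
  -- cancels the sign in the integration by parts.
  set χ : E n → ℝ := fun t => ρ (x - t) with hχ
  have hsub : ContDiff ℝ ∞ (fun t : E n => x - t) := contDiff_const.sub contDiff_id
  have hχs : ContDiff ℝ ∞ χ := hρ.comp hsub
  have hχ0 : ∀ t ∉ Metric.closedBall x r, ρ (x - t) = 0 := by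
    intro t ht
    apply image_eq_zero_of_notMem_tsupport
    intro h
    apply ht
    have := hr h
    rw [mem_closedBall_zero_iff] at this
    rwa [Metric.mem_closedBall, dist_comm, dist_eq_norm]
  have hχsupp : tsupport χ ⊆ Metric.closedBall x r :=
    closure_minimal (fun t ht => by
      by_contra h
      exact ht (hχ0 t h)) Metric.isClosed_closedBall
  have hχt : IsTest Ω χ :=
    ⟨hχs, (isCompact_closedBall x r).of_isClosed_subset (isClosed_tsupport χ) hχsupp,
      hχsupp.trans (hx.trans hKΩ)⟩
  have hfd : ∀ t v, fderiv ℝ χ t v = - fderiv ℝ ρ (x - t) v := by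
    intro t v
    have h1 : HasFDerivAt (fun t : E n => x - t) (-ContinuousLinearMap.id ℝ (E n)) t :=
      (hasFDerivAt_id t).const_sub x
    have h2 := ((hρ.differentiable (by simp)) (x - t)).hasFDerivAt.comp t h1
    have h3 : fderiv ℝ χ t = _ := h2.fderiv
    rw [h3]
    simp
  have hin : ∀ t v, inner ℝ v (gradient χ t) = - fderiv ℝ ρ (x - t) v := by
    intro t v
    rw [← hfd, real_inner_comm, ← InnerProductSpace.toDual_apply_apply (𝕜 := ℝ), toDual_gradient]
  have hgc : Continuous (gradient χ) := by
    have : gradient χ = fun t => (InnerProductSpace.toDual ℝ (E n)).symm (fderiv ℝ χ t) := rfl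
    rw [this]
    exact (LinearIsometryEquiv.continuous _).comp (hχs.continuous_fderiv (by simp))
  have hgsupp : ∀ t ∉ K, gradient χ t = 0 := by
    intro t ht
    have : fderiv ℝ χ t = 0 := image_eq_zero_of_notMem_tsupport fun h =>
      ht (hx (hχsupp (tsupport_fderiv_subset ℝ h)))
    simp [gradient, this]
  have hgcs : HasCompactSupport (gradient χ) := HasCompactSupport.intro hK hgsupp
  have e1 : ∫ t in Ω, f t • gradient χ t = ∫ t, K.indicator f t • gradient χ t := by
    rw [← setIntegral_eq_integral_of_forall_compl_eq_zero (s := Ω)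
      (f := fun t => K.indicator f t • gradient χ t)]
    · refine integral_congr_ae (Eventually.of_forall fun t => ?_)
      by_cases ht : t ∈ K
      · simp [ht]
      · simp [hgsupp t ht]
    · intro t ht
      simp [hgsupp t (fun h => ht (hKΩ h))]
  have e2 : ∫ t in Ω, χ t • F t = ∫ t, χ t • K.indicator F t := by
    rw [← setIntegral_eq_integral_of_forall_compl_eq_zero (s := Ω)
      (f := fun t => χ t • K.indicator F t)]
    · refine integral_congr_ae (Eventually.of_forall fun t => ?_)
      by_cases ht : t ∈ K
      · simp [ht]
      · have : χ t = 0 := hχ0 t fun h => ht (hx h)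
        simp [this]
    · intro t ht
      have : χ t = 0 := hχ0 t fun h => ht (hKΩ (hx h))
      simp [this]
  have key := hw.integral_eq χ hχt
  rw [e1, e2] at key
  have hi1 : Integrable fun t => K.indicator f t • gradient χ t :=
    hf.locallyIntegrable.integrable_smul_right_of_hasCompactSupport hgc hgcs
  have hi2 : Integrable fun t => χ t • K.indicator F t :=
    hF.locallyIntegrable.integrable_smul_left_of_hasCompactSupport hχs.continuous hχt.compact
  rw [← convolution_flip]
  rw [(hcρ.hasFDerivAt_convolution_right (lsmul ℝ ℝ).flip hf.locallyIntegrable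
    (hρ.of_le (by simp)) x).fderiv]
  ext v
  rw [convolution_precompR_apply _ hf.locallyIntegrable (hcρ.fderiv ℝ)
    (hρ.continuous_fderiv (by simp)), innerSL_apply_apply, real_inner_comm]
  have e3 : convolution ρ (K.indicator F) (lsmul ℝ ℝ) volume x = ∫ t, χ t • K.indicator F t :=
    convolution_eq_swap _
  rw [e3, ← neg_eq_iff_eq_neg.2 key, inner_neg_right, ← integral_inner hi1, ← integral_neg]
  unfold convolution
  congr 1
  ext1 t
  rw [inner_smul_right, hin]
  simp [mul_comm]

open ContinuousLinearMap in
/-- Mollification does not increase the `L¹` norm. -/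
theorem lintegral_convolution_le {F : E n → E n} (hF : Integrable F) {ρ : E n → ℝ}
    (hρ : Continuous ρ) (hρ0 : ∀ x, 0 ≤ ρ x) (hρi : Integrable ρ) (hρ1 : ∫ x, ρ x = 1) :
    ∫⁻ x, ‖convolution ρ F (lsmul ℝ ℝ) volume x‖ₑ ≤ ∫⁻ x, ‖F x‖ₑ := by
  have h1 : ∀ t : E n, ∫⁻ x, ‖ρ (x - t)‖ₑ = 1 := by
    intro t
    rw [lintegral_sub_right_eq_self (fun x => ‖ρ x‖ₑ) t, ← ofReal_integral_norm_eq_lintegral_enorm hρi]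
    simp_rw [Real.norm_of_nonneg (hρ0 _)]
    simp [hρ1]
  calc ∫⁻ x, ‖convolution ρ F (lsmul ℝ ℝ) volume x‖ₑ
      ≤ ∫⁻ x, ∫⁻ t, ‖ρ (x - t)‖ₑ * ‖F t‖ₑ := by
        refine lintegral_mono fun x => ?_
        rw [convolution_eq_swap]
        refine (enorm_integral_le_lintegral_enorm _).trans (le_of_eq ?_)
        simp [enorm_smul]
    _ = ∫⁻ t, ∫⁻ x, ‖ρ (x - t)‖ₑ * ‖F t‖ₑ := by
        refine lintegral_lintegral_swap ?_
        refine AEMeasurable.mul (f := fun z : E n × E n => ‖ρ (z.1 - z.2)‖ₑ)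
          (g := fun z : E n × E n => ‖F z.2‖ₑ) ?_ ?_
        · exact (hρ.measurable.comp (measurable_fst.sub measurable_snd)).enorm.aemeasurable
        · exact hF.aestronglyMeasurable.enorm.comp_snd
    _ = ∫⁻ t, ‖F t‖ₑ := by
        refine lintegral_congr fun t => ?_
        have hm : Measurable fun x => ‖ρ (x - t)‖ₑ :=
          (hρ.comp (continuous_id.sub continuous_const)).enorm.measurable
        rw [lintegral_mul_const _ hm, h1, one_mul]

/-- A generalized Fatou lemma: if `a i → a` with `∫ a i ≤ ∫ a < ∞` and `c i → c` boundedly, then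
`limsup ∫ c i * a i ≤ ∫ c * a`. -/
theorem limsup_lintegral_mul_le {α : Type*} [MeasurableSpace α] {ν : Measure α}
    {a' c' : ℕ → α → ℝ≥0∞} {a c : α → ℝ≥0∞} {M : ℝ≥0∞} (hM : M ≠ ⊤)
    (ha' : ∀ i, AEMeasurable (a' i) ν) (hc' : ∀ i, AEMeasurable (c' i) ν)
    (ha : AEMeasurable a ν) (hc : AEMeasurable c ν)
    (hle : ∀ i, ∫⁻ x, a' i x ∂ν ≤ ∫⁻ x, a x ∂ν) (hfin : ∫⁻ x, a x ∂ν ≠ ⊤)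
    (hcM : ∀ i x, c' i x ≤ M)
    (hta : ∀ᵐ x ∂ν, Tendsto (fun i => a' i x) atTop (𝓝 (a x)))
    (htc : ∀ᵐ x ∂ν, Tendsto (fun i => c' i x) atTop (𝓝 (c x))) :
    limsup (fun i => ∫⁻ x, c' i x * a' i x ∂ν) atTop ≤ ∫⁻ x, c x * a x ∂ν := by
  have hcM' : ∀ᵐ x ∂ν, c x ≤ M := by
    filter_upwards [htc] with x hx
    exact le_of_tendsto' hx fun i => hcM i x
  have hafin : ∀ᵐ x ∂ν, a x ≠ ⊤ := by
    filter_upwards [ae_lt_top' ha hfin] with x hx using hx.ne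
  -- No dominating function is available, so Fatou is applied to the nonnegative (M - c i) * a i,
  -- and the result is subtracted from M ∫ a.
  have fatou : ∫⁻ x, (M - c x) * a x ∂ν ≤
      liminf (fun i => ∫⁻ x, (M - c' i x) * a' i x ∂ν) atTop := by
    refine le_trans (lintegral_mono_ae ?_)
      (lintegral_liminf_le' fun i => ((hc' i).const_sub M).mul (ha' i))
    filter_upwards [hta, htc, hafin] with x h1 h2 h3
    refine le_of_eq (Tendsto.liminf_eq ?_).symm
    refine ENNReal.Tendsto.mul ?_ (Or.inr h3) h1 (Or.inr (ENNReal.sub_ne_top hM))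
    exact ENNReal.Tendsto.sub tendsto_const_nhds h2 (Or.inl hM)
  have hsum : ∀ i, ∫⁻ x, c' i x * a' i x ∂ν ≤
      M * ∫⁻ x, a x ∂ν - ∫⁻ x, (M - c' i x) * a' i x ∂ν := by
    intro i
    have : ∫⁻ x, (M - c' i x) * a' i x ∂ν + ∫⁻ x, c' i x * a' i x ∂ν = M * ∫⁻ x, a' i x ∂ν := by
      have hm : AEMeasurable (fun x => (M - c' i x) * a' i x) ν :=
        ((hc' i).const_sub M).mul (ha' i)
      rw [← lintegral_add_left' hm,
        ← lintegral_const_mul'' _ (ha' i)]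
      refine lintegral_congr fun x => ?_
      rw [← add_mul, tsub_add_cancel_of_le (hcM i x)]
    have h2 : ∫⁻ x, (M - c' i x) * a' i x ∂ν ≠ ⊤ := by
      refine ne_top_of_le_ne_top (ENNReal.mul_ne_top hM (ne_top_of_le_ne_top hfin (hle i))) ?_
      rw [← this]
      exact le_self_add
    refine ENNReal.le_sub_of_add_le_left h2 ?_
    rw [this]
    exact mul_le_mul_right (hle i) M
  have hsum' : ∫⁻ x, (M - c x) * a x ∂ν + ∫⁻ x, c x * a x ∂ν = M * ∫⁻ x, a x ∂ν := by
    have hm : AEMeasurable (fun x => (M - c x) * a x) ν := (hc.const_sub M).mul ha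
    rw [← lintegral_add_left' hm, ← lintegral_const_mul'' _ ha]
    refine lintegral_congr_ae ?_
    filter_upwards [hcM'] with x hx
    rw [← add_mul, tsub_add_cancel_of_le hx]
  refine (limsup_le_limsup (Eventually.of_forall hsum)).trans ?_
  rw [ENNReal.limsup_const_sub _ _ (ENNReal.mul_ne_top hM hfin)]
  refine (tsub_le_tsub_left fatou _).trans ?_
  rw [← hsum']
  refine tsub_le_iff_left.2 le_rfl

theorem enorm_gradient (φ : E n → ℝ) (x : E n) : ‖gradient φ x‖ₑ = ‖fderiv ℝ φ x‖ₑ := by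
  rw [gradient, LinearIsometryEquiv.enorm_map]

theorem IsTest.gradient_eq_zero {Ω : Set (E n)} {φ : E n → ℝ} (_hφ : IsTest Ω φ) {x : E n}
    (hx : x ∉ tsupport φ) : gradient φ x = 0 := by
  have : fderiv ℝ φ x = 0 := image_eq_zero_of_notMem_tsupport fun h =>
    hx (tsupport_fderiv_subset ℝ h)
  simp [gradient, this]

theorem IsTest.continuous_gradient {Ω : Set (E n)} {φ : E n → ℝ} (hφ : IsTest Ω φ) :
    Continuous (gradient φ) := by
  have : gradient φ = fun t => (InnerProductSpace.toDual ℝ (E n)).symm (fderiv ℝ φ t) := rfl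
  rw [this]
  exact (LinearIsometryEquiv.continuous _).comp (hφ.smooth.continuous_fderiv (by simp))

theorem limsup_add_le_of_tendsto {a b : ℕ → ℝ≥0∞} {B : ℝ≥0∞} (hb : Tendsto b atTop (𝓝 B)) :
    limsup (fun i => a i + b i) atTop ≤ limsup a atTop + B := by
  refine ENNReal.le_of_forall_pos_le_add fun ε hε hfin => ?_
  have hε' : (ε / 2 : ℝ≥0∞) ≠ 0 := by simp [hε.ne']
  rw [ENNReal.add_lt_top] at hfin
  have h1 : ∀ᶠ i in atTop, a i < limsup a atTop + ε / 2 :=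
    eventually_lt_of_limsup_lt (ENNReal.lt_add_right hfin.1.ne hε')
  have h2 : ∀ᶠ i in atTop, b i < B + ε / 2 :=
    hb.eventually_lt_const (ENNReal.lt_add_right hfin.2.ne hε')
  refine limsup_le_of_le (h := ?_)
  filter_upwards [h1, h2] with i hi1 hi2
  calc a i + b i ≤ (limsup a atTop + ε / 2) + (B + ε / 2) := add_le_add hi1.le hi2.le
    _ = limsup a atTop + B + (ε / 2 + ε / 2) := by ring
    _ = limsup a atTop + B + ε := by rw [ENNReal.add_halves]

open ContinuousLinearMap in
/-- The Gagliardo–Nirenberg–Sobolev inequality for `g(f) φ`, with `f` bounded and weakly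
differentiable, `g` of class `C¹` and `φ` a test function. -/
theorem lintegral_comp_mul_rpow_le {p' : ℝ} (hp' : Real.HolderConjugate n p')
    {Ω : Set (E n)} (hΩ : IsOpen Ω) {f : E n → ℝ} {F : E n → E n} (hw : IsWeakGradient Ω f F)
    {k : ℝ} (hfk : ∀ x, |f x| ≤ k) {g : ℝ → ℝ} (hg : ContDiff ℝ 1 g) {φ : E n → ℝ}
    (hφ : IsTest Ω φ) :
    ∫⁻ x, ‖g (f x) * φ x‖ₑ ^ p' ≤
      lintegralPowLePowLIntegralFDerivConst (volume : Measure (E n)) p' *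
      ((∫⁻ x in Ω, ‖φ x‖ₑ * ‖deriv g (f x)‖ₑ * ‖F x‖ₑ) +
        ∫⁻ x in Ω, ‖g (f x)‖ₑ * ‖gradient φ x‖ₑ) ^ p' := by
  set C := lintegralPowLePowLIntegralFDerivConst (volume : Measure (E n)) p'
  have hk : 0 ≤ k := (abs_nonneg _).trans (hfk 0)
  -- At points of the support of φ, a kernel of radius at most δ sees only K, so cutting f and F off
  -- outside K does no harm there.
  obtain ⟨δ, hδ, hδΩ⟩ := hφ.compact.isCompact.exists_cthickening_subset_open hΩ hφ.support
  set K := Metric.cthickening δ (tsupport φ)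
  have hK : IsCompact K := hφ.compact.isCompact.cthickening
  have hKm : MeasurableSet K := hK.measurableSet
  have hSK : tsupport φ ⊆ K := Metric.self_subset_cthickening _
  set f' := K.indicator f
  set F' := K.indicator F
  have hf : Integrable f' := by
    rw [integrable_indicator_iff hKm]
    have := hw.locInt_fun K hK hδΩ
    rw [ENNReal.ofReal_one, memLp_one_iff_integrable] at this
    exact this
  have hF : Integrable F' := by
    rw [integrable_indicator_iff hKm]
    have := hw.locInt_grad K hK hδΩ
    rw [ENNReal.ofReal_one, memLp_one_iff_integrable] at this
    exact this
  let b : ℕ → ContDiffBump (0 : E n) := fun i =>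
    ⟨δ / (2 * (i + 1)), δ / (i + 1), by positivity, by
      apply div_lt_div_of_pos_left hδ (by positivity)
      have : (0 : ℝ) ≤ i := Nat.cast_nonneg i
      linarith⟩
  have hbout : ∀ i, (b i).rOut = δ / (i + 1) := fun i => rfl
  have hbin : ∀ i, (b i).rIn = δ / (2 * (i + 1)) := fun i => rfl
  have hb0 : Tendsto (fun i => (b i).rOut) atTop (𝓝 0) := by
    simp_rw [hbout]
    have := (tendsto_one_div_add_atTop_nhds_zero_nat (𝕜 := ℝ)).const_mul δ
    simpa [div_eq_mul_inv] using this
  have hb2 : ∀ᶠ i in atTop, (b i).rOut ≤ 2 * (b i).rIn := by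
    refine Eventually.of_forall fun i => le_of_eq ?_
    rw [hbout, hbin]
    field_simp
  have hbδ : ∀ i, (b i).rOut ≤ δ := by
    intro i
    rw [hbout]
    apply div_le_self hδ.le
    have : (0 : ℝ) ≤ i := Nat.cast_nonneg i
    linarith
  let ρ : ℕ → E n → ℝ := fun i => (b i).normed volume
  have hρs : ∀ i, ContDiff ℝ ∞ (ρ i) := fun i => (b i).contDiff_normed
  have hρc : ∀ i, HasCompactSupport (ρ i) := fun i => (b i).hasCompactSupport_normed
  have hρt : ∀ i, tsupport (ρ i) ⊆ Metric.closedBall 0 δ := fun i => by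
    rw [(b i).tsupport_normed_eq]
    exact Metric.closedBall_subset_closedBall (hbδ i)
  have hρ0 : ∀ i x, 0 ≤ ρ i x := fun i x => (b i).nonneg_normed x
  have hρi : ∀ i, Integrable (ρ i) := fun i => (b i).integrable_normed
  have hρ1 : ∀ i, ∫ x, ρ i x = 1 := fun i => (b i).integral_normed
  let fm : ℕ → E n → ℝ := fun i => convolution (ρ i) f' (lsmul ℝ ℝ) volume
  let Fm : ℕ → E n → E n := fun i => convolution (ρ i) F' (lsmul ℝ ℝ) volume
  have hfms : ∀ i, ContDiff ℝ ∞ (fm i) := fun i =>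
    (hρc i).contDiff_convolution_left _ (hρs i) hf.locallyIntegrable
  have hFms : ∀ i, Continuous (Fm i) := fun i =>
    ((hρc i).contDiff_convolution_left (n := 1) _ ((hρs i).of_le (by simp))
      hF.locallyIntegrable).continuous
  have hfd : ∀ i, ∀ x ∈ tsupport φ, ‖fderiv ℝ (fm i) x‖ₑ = ‖Fm i x‖ₑ := by
    intro i x hx
    have hball : Metric.closedBall x δ ⊆ K := Metric.closedBall_subset_cthickening hx δ
    have := hw.fderiv_convolution hK hδΩ (hρs i) (hρt i) hball
    change ‖fderiv ℝ (convolution (ρ i) (K.indicator f) (lsmul ℝ ℝ) volume) x‖ₑ = _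
    rw [this, ← ofReal_norm, innerSL_apply_norm, ofReal_norm]
  -- The bound of f survives averaging, so g and its derivative matter only on [-k, k], where they
  -- are bounded.
  have hfmk : ∀ i x, |fm i x| ≤ k := by
    intro i x
    have e : fm i x = ∫ t, ρ i (x - t) • f' t := convolution_eq_swap _
    rw [e, ← Real.norm_eq_abs]
    have hI : Integrable fun t => ρ i (x - t) * k :=
      ((hρi i).comp_sub_left x).mul_const k
    refine (norm_integral_le_of_norm_le hI (Eventually.of_forall fun t => ?_)).trans (le_of_eq ?_)
    · rw [norm_smul, Real.norm_of_nonneg (hρ0 _ _)]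
      refine mul_le_mul_of_nonneg_left ?_ (hρ0 _ _)
      by_cases ht : t ∈ K
      · simpa [f', ht] using hfk t
      · simpa [f', ht] using hk
    · rw [integral_mul_const, integral_sub_left_eq_self (ρ i) volume x, hρ1, one_mul]
  have haef : ∀ᵐ x, Tendsto (fun i => fm i x) atTop (𝓝 (f' x)) :=
    ContDiffBump.ae_convolution_tendsto_right_of_locallyIntegrable hb0 hb2 hf.locallyIntegrable
  have haeF : ∀ᵐ x, Tendsto (fun i => Fm i x) atTop (𝓝 (F' x)) :=
    ContDiffBump.ae_convolution_tendsto_right_of_locallyIntegrable hb0 hb2 hF.locallyIntegrable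
  have hgd : Continuous (deriv g) := hg.continuous_deriv le_rfl
  have hgc : Continuous g := hg.continuous
  obtain ⟨M1, hM1⟩ := isCompact_Icc.exists_bound_of_continuousOn (s := Set.Icc (-k) k)
    hgd.continuousOn
  obtain ⟨M0, hM0⟩ := isCompact_Icc.exists_bound_of_continuousOn (s := Set.Icc (-k) k)
    hgc.continuousOn
  obtain ⟨M2, hM2⟩ := hφ.compact.exists_bound_of_continuous hφ.smooth.continuous
  have hφc : Continuous φ := hφ.smooth.continuous
  -- the smooth inequality
  have hsm : ∀ i, ∫⁻ x, ‖g (fm i x) * φ x‖ₑ ^ p' ≤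
      C * ((∫⁻ x, (‖φ x‖ₑ * ‖deriv g (fm i x)‖ₑ) * ‖Fm i x‖ₑ) +
        ∫⁻ x, ‖g (fm i x)‖ₑ * ‖gradient φ x‖ₑ) ^ p' := by
    intro i
    have hu : ContDiff ℝ 1 fun x => g (fm i x) * φ x :=
      (hg.comp ((hfms i).of_le (by simp))).mul (hφ.smooth.of_le (by simp))
    have huc : HasCompactSupport fun x => g (fm i x) * φ x := hφ.compact.mul_left
    have hfr : Real.HolderConjugate (Module.finrank ℝ (E n)) p' := by
      simpa using hp'
    refine (lintegral_pow_le_pow_lintegral_fderiv volume hu huc hfr).trans ?_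
    have hm : AEMeasurable (fun x => (‖φ x‖ₑ * ‖deriv g (fm i x)‖ₑ) * ‖Fm i x‖ₑ) volume := by
      have h1 : Continuous fun x => deriv g (fm i x) := hgd.comp (hfms i).continuous
      exact ((hφc.enorm.measurable.mul h1.enorm.measurable).mul
        (hFms i).enorm.measurable).aemeasurable
    rw [← lintegral_add_left' hm]
    refine mul_le_mul_right (ENNReal.rpow_le_rpow (lintegral_mono fun x => ?_) hp'.symm.nonneg) _
    have h1 : HasFDerivAt (fun x => g (fm i x)) (deriv g (fm i x) • fderiv ℝ (fm i) x) x :=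
      ((hg.differentiable (by simp) (fm i x)).hasDerivAt).comp_hasFDerivAt x
        ((hfms i).differentiable (by simp) x).hasFDerivAt
    have h2 := (h1.fun_mul ((hφ.smooth.differentiable (by simp) x).hasFDerivAt)).fderiv
    rw [h2]
    by_cases hx : x ∈ tsupport φ
    · have h5 := enorm_add_le (g (fm i x) • fderiv ℝ φ x)
        (φ x • deriv g (fm i x) • fderiv ℝ (fm i) x)
      rw [enorm_smul, enorm_smul, enorm_smul, hfd i x hx, ← enorm_gradient, add_comm (_ * _),
        ← mul_assoc] at h5
      exact h5
    · have h3 : φ x = 0 := image_eq_zero_of_notMem_tsupport hx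
      have h4 : fderiv ℝ φ x = 0 := image_eq_zero_of_notMem_tsupport fun h =>
        hx (tsupport_fderiv_subset ℝ h)
      rw [h3, h4, smul_zero, zero_smul, add_zero]
      exact (enorm_zero (E := E n →L[ℝ] ℝ)).trans_le zero_le
  -- passage to the limit in the two terms on the right
  have hlim1 : limsup (fun i => ∫⁻ x, (‖φ x‖ₑ * ‖deriv g (fm i x)‖ₑ) * ‖Fm i x‖ₑ) atTop ≤
      ∫⁻ x in Ω, ‖φ x‖ₑ * ‖deriv g (f x)‖ₑ * ‖F x‖ₑ := by
    -- The mollified gradients converge a.e. with L¹ norms at most that of the limit, while their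
    -- coefficients are bounded and converge a.e.
    have h := limsup_lintegral_mul_le (ν := volume)
      (a' := fun i x => ‖Fm i x‖ₑ) (a := fun x => ‖F' x‖ₑ)
      (c' := fun i x => ‖φ x‖ₑ * ‖deriv g (fm i x)‖ₑ)
      (c := fun x => ‖φ x‖ₑ * ‖deriv g (f' x)‖ₑ)
      (M := ENNReal.ofReal M2 * ENNReal.ofReal M1)
      (ENNReal.mul_ne_top ENNReal.ofReal_ne_top ENNReal.ofReal_ne_top)
      (fun i => (hFms i).enorm.measurable.aemeasurable)
      (fun i => (hφc.enorm.measurable.mul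
        (hgd.comp (hfms i).continuous).enorm.measurable).aemeasurable)
      hF.aestronglyMeasurable.enorm
      (hφc.enorm.measurable.aemeasurable.mul
        (hgd.measurable.comp_aemeasurable hf.aestronglyMeasurable.aemeasurable).enorm)
      (fun i => lintegral_convolution_le hF (hρs i).continuous (hρ0 i) (hρi i) (hρ1 i))
      hF.2.ne
      (fun i x => by
        refine mul_le_mul' ?_ ?_
        · rw [← ofReal_norm]
          exact ENNReal.ofReal_le_ofReal (hM2 x)
        · rw [← ofReal_norm]
          exact ENNReal.ofReal_le_ofReal (hM1 _ (abs_le.1 (hfmk i x))))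
      (by filter_upwards [haeF] with x hx using hx.enorm)
      (by
        filter_upwards [haef] with x hx
        refine ENNReal.Tendsto.const_mul (((hgd.tendsto _).comp hx).enorm) (Or.inr enorm_ne_top))
    refine h.trans ?_
    rw [← lintegral_indicator hΩ.measurableSet]
    refine lintegral_mono fun x => ?_
    by_cases hx : x ∈ K
    · rw [Set.indicator_of_mem (hδΩ hx)]
      simp [f', F', hx]
    · simp [F', hx]
  have hlim2 : Tendsto (fun i => ∫⁻ x, ‖g (fm i x)‖ₑ * ‖gradient φ x‖ₑ) atTop
      (𝓝 (∫⁻ x, ‖g (f' x)‖ₑ * ‖gradient φ x‖ₑ)) := by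
    refine tendsto_lintegral_of_dominated_convergence
      (fun x => ENNReal.ofReal M0 * ‖gradient φ x‖ₑ) ?_ ?_ ?_ ?_
    · exact fun i => ((hgc.comp (hfms i).continuous).enorm.measurable).mul
        hφ.continuous_gradient.enorm.measurable
    · refine fun i => Eventually.of_forall fun x => mul_le_mul_left ?_ _
      rw [← ofReal_norm]
      exact ENNReal.ofReal_le_ofReal (hM0 _ (abs_le.1 (hfmk i x)))
    · rw [lintegral_const_mul _ hφ.continuous_gradient.enorm.measurable]
      refine ENNReal.mul_ne_top ENNReal.ofReal_ne_top ?_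
      exact (hφ.continuous_gradient.integrable_of_hasCompactSupport
        (HasCompactSupport.intro hφ.compact fun x hx => hφ.gradient_eq_zero hx)).2.ne
    · filter_upwards [haef] with x hx
      exact ENNReal.Tendsto.mul_const (((hgc.tendsto _).comp hx).enorm) (Or.inr enorm_ne_top)
  have hlim2' : ∫⁻ x, ‖g (f' x)‖ₑ * ‖gradient φ x‖ₑ ≤
      ∫⁻ x in Ω, ‖g (f x)‖ₑ * ‖gradient φ x‖ₑ := by
    rw [← lintegral_indicator hΩ.measurableSet]
    refine lintegral_mono fun x => ?_
    by_cases hx : x ∈ tsupport φ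
    · rw [Set.indicator_of_mem (hφ.support hx)]
      simp [f', hSK hx]
    · simp [hφ.gradient_eq_zero hx]
  -- conclusion by Fatou's lemma
  set R : ℕ → ℝ≥0∞ := fun i => (∫⁻ x, (‖φ x‖ₑ * ‖deriv g (fm i x)‖ₑ) * ‖Fm i x‖ₑ) +
        ∫⁻ x, ‖g (fm i x)‖ₑ * ‖gradient φ x‖ₑ with hR
  have hRlim : limsup R atTop ≤ (∫⁻ x in Ω, ‖φ x‖ₑ * ‖deriv g (f x)‖ₑ * ‖F x‖ₑ) +
        ∫⁻ x in Ω, ‖g (f x)‖ₑ * ‖gradient φ x‖ₑ := by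
    exact (limsup_add_le_of_tendsto hlim2).trans (add_le_add hlim1 hlim2')
  have hmono : Monotone fun r : ℝ≥0∞ => (C : ℝ≥0∞) * r ^ p' := fun r s h =>
    mul_le_mul_right (ENNReal.rpow_le_rpow h hp'.symm.nonneg) _
  have hcont : Continuous fun r : ℝ≥0∞ => (C : ℝ≥0∞) * r ^ p' :=
    (ENNReal.continuous_const_mul ENNReal.coe_ne_top).comp ENNReal.continuous_rpow_const
  calc ∫⁻ x, ‖g (f x) * φ x‖ₑ ^ p'
      ≤ ∫⁻ x, liminf (fun i => ‖g (fm i x) * φ x‖ₑ ^ p') atTop := by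
        refine lintegral_mono_ae ?_
        filter_upwards [haef] with x hx
        by_cases hxs : x ∈ tsupport φ
        · have h1 : f' x = f x := by simp [f', hSK hxs]
          rw [h1] at hx
          refine le_of_eq (Tendsto.liminf_eq ?_).symm
          exact (ENNReal.continuous_rpow_const.tendsto _).comp
            ((((hgc.tendsto _).comp hx).mul_const _).enorm)
        · have h3 : φ x = 0 := image_eq_zero_of_notMem_tsupport hxs
          simp [h3, hp'.symm.pos]
    _ ≤ liminf (fun i => ∫⁻ x, ‖g (fm i x) * φ x‖ₑ ^ p') atTop := by
        refine lintegral_liminf_le' fun i => ?_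
        exact (((hgc.comp (hfms i).continuous).mul hφc).enorm.measurable.pow_const _).aemeasurable
    _ ≤ limsup (fun i => (C : ℝ≥0∞) * R i ^ p') atTop :=
        (liminf_le_liminf (Eventually.of_forall hsm)).trans liminf_le_limsup
    _ = C * (limsup R atTop) ^ p' :=
        (hmono.map_limsup_of_continuousAt R hcont.continuousAt).symm
    _ ≤ _ := hmono hRlim

/-! ### Pointwise inequalities of Young type -/

/-- Young's inequality by comparing w with S^(1 + ε), where the two terms on the right are equal.
The hypothesis on κ means κ ≤ (1 + ε)(q - 1) - ε. With w = |∇u|/d and S = 1 + y, the right side is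
what the Caccioppoli inequality controls. -/
theorem mul_rpow_le_rpow_mul_add {q ε κ w S : ℝ} (hq : 1 < q) (hκ : κ - 1 ≤ (1 + ε) * (q - 2))
    (hw : 0 ≤ w) (hS : 1 ≤ S) :
    w * S ^ (κ - 1) ≤ w ^ q * S ^ (-1 - ε) + S ^ ((1 + ε) * (q - 1)) := by
  have hS0 : 0 < S := by linarith
  have h1 : w * S ^ (κ - 1) ≤ w * S ^ ((1 + ε) * (q - 2)) :=
    mul_le_mul_of_nonneg_left (Real.rpow_le_rpow_of_exponent_le hS hκ) hw
  refine h1.trans ?_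
  rcases le_total w (S ^ (1 + ε)) with h | h
  · have : w * S ^ ((1 + ε) * (q - 2)) ≤ S ^ ((1 + ε) * (q - 1)) := by
      calc w * S ^ ((1 + ε) * (q - 2)) ≤ S ^ (1 + ε) * S ^ ((1 + ε) * (q - 2)) := by gcongr
        _ = S ^ ((1 + ε) * (q - 1)) := by rw [← Real.rpow_add hS0]; ring_nf
    have h2 : 0 ≤ w ^ q * S ^ (-1 - ε) := by positivity
    linarith
  · have hw0 : 0 < w := lt_of_lt_of_le (by positivity) h
    have h2 : 0 ≤ S ^ ((1 + ε) * (q - 1)) := by positivity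
    have : w * S ^ ((1 + ε) * (q - 2)) ≤ w ^ q * S ^ (-1 - ε) := by
      calc w * S ^ ((1 + ε) * (q - 2))
          = w * ((S ^ (1 + ε)) ^ (q - 1) * S ^ (-1 - ε)) := by
            rw [← Real.rpow_mul hS0.le, ← Real.rpow_add hS0]; ring_nf
        _ ≤ w * (w ^ (q - 1) * S ^ (-1 - ε)) := by
            have := Real.rpow_le_rpow (by positivity) h (by linarith : 0 ≤ q - 1)
            gcongr
        _ = w ^ q * S ^ (-1 - ε) := by
            rw [← mul_assoc, ← Real.rpow_one_add' hw0.le (by linarith)]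
            ring_nf
    linarith

/-- Absorbs the cut-off term of the Caccioppoli inequality, for r = p and r = q alike. The two cases
compare z * η with the value B at which half of the energy density balances the left side. Below B,
η^(N-1) ≤ η^(r-1) because r ≤ N, and B^(r-1) ≤ B^(q-1) because B ≥ 1; this is where d ≥ 1 makes the
p-term harmless. -/
theorem rpow_mul_pow_le {q r ε z η M d S : ℝ} {N : ℕ} (hr : 1 < r) (hrq : r ≤ q) (hqN : q ≤ N)
    (hε : 0 < ε) (hε1 : ε ≤ 1) (hz : 0 ≤ z) (hη : 0 ≤ η) (hη1 : η ≤ 1) (hM : 1 ≤ M) (hd : 1 ≤ d)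
    (hS : 1 ≤ S) :
    z ^ (r - 1) * (N * η ^ (N - 1) * M) ≤
      1 / 2 * (z ^ r * (ε / d * S ^ (-1 - ε)) * η ^ N) +
        (N * M) ^ q * (2 * d / ε) ^ (q - 1) * S ^ ((1 + ε) * (q - 1)) := by
  have hS0 : 0 < S := by linarith
  have hN1 : 1 < (N : ℝ) := by linarith
  have hN0 : N ≠ 0 := by rintro rfl; norm_num at hN1
  have hNM : 1 ≤ N * M := by nlinarith
  have hde : 1 ≤ 2 * d / ε := by rw [le_div_iff₀ hε]; linarith
  have hSe : 1 ≤ S ^ (1 + ε) := Real.one_le_rpow hS (by linarith)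
  set B := N * M * (2 * d / ε) * S ^ (1 + ε) with hB
  have hB1 : 1 ≤ B := one_le_mul_of_one_le_of_one_le (one_le_mul_of_one_le_of_one_le hNM hde) hSe
  rcases le_total (z * η) B with h | h
  · have h1 : η ^ (N - 1) ≤ η ^ (r - 1) := by
      rcases hη.eq_or_lt with h0 | h0
      · rw [← h0, zero_pow (by
          intro h; have : N = 1 := by omega
          subst this; norm_num at hN1)]
        positivity
      · rw [← Real.rpow_natCast]
        refine Real.rpow_le_rpow_of_exponent_ge h0 hη1 ?_
        rw [Nat.cast_sub (by omega)]
        push_cast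
        linarith
    have h2 : z ^ (r - 1) * (N * η ^ (N - 1) * M) ≤
        (N * M) ^ q * (2 * d / ε) ^ (q - 1) * S ^ ((1 + ε) * (q - 1)) := by
      calc z ^ (r - 1) * (N * η ^ (N - 1) * M) ≤ z ^ (r - 1) * (N * η ^ (r - 1) * M) := by gcongr
        _ = (z * η) ^ (r - 1) * (N * M) := by rw [Real.mul_rpow hz hη]; ring
        _ ≤ B ^ (r - 1) * (N * M) := by
            have := Real.rpow_le_rpow (by positivity) h (by linarith : 0 ≤ r - 1)
            gcongr
        _ ≤ B ^ (q - 1) * (N * M) := by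
            have := Real.rpow_le_rpow_of_exponent_le hB1 (by linarith : r - 1 ≤ q - 1)
            gcongr
        _ = _ := by
            rw [hB, Real.mul_rpow (by positivity) (by positivity),
              Real.mul_rpow (by positivity) (by positivity), ← Real.rpow_mul hS0.le]
            have : (N * M : ℝ) ^ q = (N * M) ^ (q - 1) * (N * M) := by
              rw [← Real.rpow_add_one (by positivity)]; ring_nf
            rw [this]; ring
    have h3 : 0 ≤ 1 / 2 * (z ^ r * (ε / d * S ^ (-1 - ε)) * η ^ N) := by positivity
    linarith
  · have hz0 : 0 < z := by
      rcases hz.eq_or_lt with h0 | h0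
      · rw [← h0] at h; linarith
      · exact h0
    have h3 : N * M ≤ z * η * (ε / (2 * d)) * S ^ (-1 - ε) := by
      have e : S ^ (-1 - ε) = (S ^ (1 + ε))⁻¹ := by rw [← Real.rpow_neg hS0.le]; ring_nf
      have h4 : B * (ε / (2 * d)) * S ^ (-1 - ε) = N * M := by
        rw [e, hB]; field_simp
      rw [← h4]
      gcongr
    have h5 : z ^ (r - 1) * (N * η ^ (N - 1) * M) ≤
        1 / 2 * (z ^ r * (ε / d * S ^ (-1 - ε)) * η ^ N) := by
      calc z ^ (r - 1) * (N * η ^ (N - 1) * M) = z ^ (r - 1) * η ^ (N - 1) * (N * M) := by ring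
        _ ≤ z ^ (r - 1) * η ^ (N - 1) * (z * η * (ε / (2 * d)) * S ^ (-1 - ε)) := by gcongr
        _ = _ := by
            have e1 : z ^ r = z ^ (r - 1) * z := by
              rw [← Real.rpow_add_one hz0.ne']; ring_nf
            have e2 : η ^ N = η ^ (N - 1) * η := by rw [← pow_succ]; congr; omega
            rw [e1, e2]; field_simp
    have h6 : 0 ≤ (N * M) ^ q * (2 * d / ε) ^ (q - 1) * S ^ ((1 + ε) * (q - 1)) := by positivity
    linarith

/-! ### The power-like profile inserted into the Sobolev inequality -/

/-- The profile `s₊² (1 + s₊)^{κ - 2}`. -/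
def profile (κ s : ℝ) : ℝ := (max s 0) ^ 2 * (1 + max s 0) ^ (κ - 2)

/-- The derivative of `profile κ`. -/
def profileDeriv (κ s : ℝ) : ℝ :=
  2 * max s 0 * (1 + max s 0) ^ (κ - 2) + (max s 0) ^ 2 * ((κ - 2) * (1 + max s 0) ^ (κ - 3))

theorem continuous_profileDeriv (κ : ℝ) : Continuous (profileDeriv κ) := by
  have h (a : ℝ) : Continuous fun s : ℝ => (1 + max s 0) ^ a :=
    (continuous_const.add (continuous_id.max continuous_const)).rpow_const fun s => Or.inl
      (by have := le_max_right s 0; simp only [id]; exact (by linarith : (0 : ℝ) < 1 + max s 0).ne')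
  have h0 : Continuous fun s : ℝ => max s 0 := continuous_id.max continuous_const
  exact ((continuous_const.mul h0).mul (h _)).add ((h0.pow 2).mul (continuous_const.mul (h _)))

/-- The square makes the derivative continuous at 0, so the formula, computed separately on each
side of 0, extends to 0. -/
theorem hasDerivAt_profile (κ s : ℝ) : HasDerivAt (profile κ) (profileDeriv κ s) s := by
  have hc : Continuous (profile κ) :=
    ((continuous_id.max continuous_const).pow 2).mul
      ((continuous_const.add (continuous_id.max continuous_const)).rpow_const fun s => Or.inl
        (by have := le_max_right s 0; simp only [id]; exact (by linarith : (0 : ℝ) < 1 + max s 0).ne'))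
  refine hasDerivAt_of_hasDerivAt_of_ne' (x := 0) ?_ hc.continuousAt
    (continuous_profileDeriv κ).continuousAt s
  intro y hy
  rcases lt_or_gt_of_ne hy with h | h
  · have e : profile κ =ᶠ[𝓝 y] fun _ => 0 := by
      filter_upwards [Iio_mem_nhds h] with t ht
      simp [profile, max_eq_right (Set.mem_Iio.1 ht).le]
    have e2 : profileDeriv κ y = 0 := by simp [profileDeriv, max_eq_right h.le]
    rw [e2]
    exact (hasDerivAt_const y (0 : ℝ)).congr_of_eventuallyEq e
  · have e : profile κ =ᶠ[𝓝 y] fun s => s ^ 2 * (1 + s) ^ (κ - 2) := by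
      filter_upwards [Ioi_mem_nhds h] with t ht
      simp [profile, max_eq_left (Set.mem_Ioi.1 ht).le]
    have h1 : HasDerivAt (fun s : ℝ => 1 + s) 1 y := (hasDerivAt_id y).const_add 1
    have h2 := h1.rpow_const (p := κ - 2) (Or.inl (by linarith : (1 : ℝ) + y ≠ 0))
    have h3 := (hasDerivAt_pow 2 y).mul h2
    refine HasDerivAt.congr_of_eventuallyEq ?_ e
    have h4 : profileDeriv κ y = ↑2 * y ^ (2 - 1) * (1 + y) ^ (κ - 2) +
        y ^ 2 * (1 * (κ - 2) * (1 + y) ^ (κ - 2 - 1)) := by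
      have : κ - 3 = κ - 2 - 1 := by ring
      simp [profileDeriv, max_eq_left h.le, this]
    rw [h4]
    exact h3

theorem contDiff_profile (κ : ℝ) : ContDiff ℝ 1 (profile κ) := by
  rw [contDiff_one_iff_deriv]
  refine ⟨fun s => (hasDerivAt_profile κ s).differentiableAt, ?_⟩
  have : deriv (profile κ) = profileDeriv κ := funext fun s => (hasDerivAt_profile κ s).deriv
  rw [this]
  exact continuous_profileDeriv κ

theorem profile_of_nonpos {κ s : ℝ} (hs : s ≤ 0) : profile κ s = 0 := by
  simp [profile, max_eq_right hs]

theorem profileDeriv_of_nonpos {κ s : ℝ} (hs : s ≤ 0) : profileDeriv κ s = 0 := by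
  simp [profileDeriv, max_eq_right hs]

theorem profile_nonneg (κ s : ℝ) : 0 ≤ profile κ s := by
  have := le_max_right s 0
  unfold profile
  positivity

theorem profile_le {κ s : ℝ} (hs : 0 ≤ s) : profile κ s ≤ (1 + s) ^ κ := by
  have h1 : (1 + s) ^ κ = (1 + s) ^ 2 * (1 + s) ^ (κ - 2) := by
    rw [← Real.rpow_natCast, ← Real.rpow_add (by linarith)]; ring_nf
  rw [profile, max_eq_left hs, h1]
  gcongr
  linarith

theorem abs_profileDeriv_le {κ s : ℝ} (hs : 0 ≤ s) :
    |profileDeriv κ s| ≤ (2 + |κ - 2|) * (1 + s) ^ (κ - 1) := by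
  have hs1 : 0 < 1 + s := by linarith
  have h1 : (1 + s) ^ (κ - 1) = (1 + s) * (1 + s) ^ (κ - 2) := by
    rw [mul_comm, ← Real.rpow_add_one hs1.ne']; ring_nf
  have h2 : (1 + s) ^ (κ - 1) = (1 + s) ^ 2 * (1 + s) ^ (κ - 3) := by
    rw [← Real.rpow_natCast, ← Real.rpow_add hs1]; ring_nf
  rw [profileDeriv, max_eq_left hs]
  refine (abs_add_le _ _).trans ?_
  rw [add_mul, abs_of_nonneg (by positivity : 0 ≤ 2 * s * (1 + s) ^ (κ - 2))]
  refine add_le_add ?_ ?_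
  · rw [h1, mul_assoc]
    gcongr
    linarith
  · rw [abs_mul, abs_mul, abs_of_nonneg (by positivity : 0 ≤ s ^ 2),
      abs_of_nonneg (by positivity : 0 ≤ (1 + s) ^ (κ - 3)), h2]
    calc s ^ 2 * (|κ - 2| * (1 + s) ^ (κ - 3)) ≤ (1 + s) ^ 2 * (|κ - 2| * (1 + s) ^ (κ - 3)) := by
          gcongr; linarith
      _ = _ := by ring

/-- For s ≥ τ and τ ≤ 1, s ≥ (τ / 2)(1 + s). So the double zero of the profile costs only a factor
τ² away from 0, a geometric factor in the iteration. -/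
theorem le_profile {κ s τ : ℝ} (hκ : 0 ≤ κ) (hτ : 0 < τ) (hτ1 : τ ≤ 1) (hs : τ ≤ s) :
    τ ^ 2 / 4 * s ^ κ ≤ profile κ s := by
  have hs0 : 0 < s := by linarith
  have h1 : (1 + s) ^ κ = (1 + s) ^ 2 * (1 + s) ^ (κ - 2) := by
    rw [← Real.rpow_natCast, ← Real.rpow_add (by linarith)]; ring_nf
  rw [profile, max_eq_left hs0.le]
  have h2 : τ / 2 * (1 + s) ≤ s := by nlinarith
  calc τ ^ 2 / 4 * s ^ κ ≤ τ ^ 2 / 4 * (1 + s) ^ κ := by gcongr; linarith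
    _ = (τ / 2 * (1 + s)) ^ 2 * (1 + s) ^ (κ - 2) := by rw [h1]; ring
    _ ≤ s ^ 2 * (1 + s) ^ (κ - 2) := by gcongr

/-! ### The damping function used as renormalizer -/

/-- The bounded nonincreasing function `1 - (1 + s)^{-ε}` of `s = min (k, -t/d - m)₊`. -/
def damping (ε d m k t : ℝ) : ℝ := 1 - (1 + max 0 (min (-t / d - m) k)) ^ (-ε)

section damping

variable {ε d m k : ℝ}

theorem damping_nonneg (hε : 0 < ε) (t : ℝ) : 0 ≤ damping ε d m k t := by
  have h : (1 + max 0 (min (-t / d - m) k)) ^ (-ε) ≤ 1 :=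
    Real.rpow_le_one_of_one_le_of_nonpos (by have := le_max_left 0 (min (-t / d - m) k); linarith)
      (by linarith)
  unfold damping
  linarith

theorem damping_le_one (t : ℝ) : damping ε d m k t ≤ 1 := by
  have h : 0 ≤ (1 + max 0 (min (-t / d - m) k)) ^ (-ε) := by
    have := le_max_left 0 (min (-t / d - m) k); positivity
  unfold damping
  linarith

theorem damping_of_nonpos {t : ℝ} (ht : -t / d - m ≤ 0) : damping ε d m k t = 0 := by
  have : max 0 (min (-t / d - m) k) = 0 := max_eq_left ((min_le_left _ _).trans ht)
  simp [damping, this]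

theorem damping_of_le (hk : 0 ≤ k) {t : ℝ} (ht : k ≤ -t / d - m) :
    damping ε d m k t = 1 - (1 + k) ^ (-ε) := by
  rw [damping, min_eq_right ht, max_eq_right hk]

theorem antitone_damping (hε : 0 < ε) (hd : 0 < d) : Antitone (damping ε d m k) := by
  intro s t hst
  unfold damping
  have h0 := le_max_left 0 (min (-t / d - m) k)
  refine sub_le_sub_left (Real.rpow_le_rpow_of_nonpos (by linarith) ?_ (by linarith)) 1
  gcongr

theorem hasDerivAt_damping (hd : 0 < d) {t : ℝ} (h0 : 0 < -t / d - m)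
    (hk : -t / d - m < k) :
    HasDerivAt (damping ε d m k) (-(ε / d * (1 + (-t / d - m)) ^ (-1 - ε))) t := by
  have hc : Continuous fun t : ℝ => -t / d - m := by fun_prop
  have e : damping ε d m k =ᶠ[𝓝 t] fun t => 1 - (1 + (-t / d - m)) ^ (-ε) := by
    filter_upwards [hc.continuousAt.eventually_const_lt h0, hc.continuousAt.eventually_lt_const hk]
      with s h1 h2
    rw [damping, min_eq_left h2.le, max_eq_right h1.le]
  refine HasDerivAt.congr_of_eventuallyEq ?_ e
  have h1 : HasDerivAt (fun t : ℝ => 1 + (-t / d - m)) (-1 / d) t :=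
    (((hasDerivAt_id t).neg.div_const d).sub_const m).const_add 1
  have h2 := (h1.rpow_const (p := -ε) (Or.inl (by linarith))).const_sub 1
  convert h2 using 1
  have : -ε - 1 = -1 - ε := by ring
  rw [this]
  field_simp

theorem exists_lipschitzWith_damping (hε : 0 < ε) :
    ∃ L, LipschitzWith L (damping ε d m k) := by
  have h1 : LipschitzOnWith (Real.toNNReal ε) (fun y : ℝ => (1 + y) ^ (-ε)) (Set.Ici 0) := by
    refine (convex_Ici 0).lipschitzOnWith_of_nnnorm_hasDerivWithin_le
      (f' := fun y => 1 * (-ε) * (1 + y) ^ (-ε - 1)) (fun y hy => ?_) (fun y hy => ?_)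
    · have hy : (0 : ℝ) ≤ y := hy
      exact (((hasDerivAt_id y).const_add 1).rpow_const
        (Or.inl (by simp only [id]; linarith))).hasDerivWithinAt
    · have hy : (0 : ℝ) ≤ y := hy
      rw [← NNReal.coe_le_coe, Real.coe_toNNReal _ hε.le, coe_nnnorm, norm_mul, one_mul, norm_neg,
        Real.norm_of_nonneg hε.le, Real.norm_of_nonneg (by positivity)]
      refine mul_le_of_le_one_right hε.le (Real.rpow_le_one_of_one_le_of_nonpos ?_ ?_) <;> linarith
  have h2 : LipschitzWith (Real.toNNReal |1 / d|) fun t : ℝ => -t / d - m := by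
    refine LipschitzWith.of_dist_le_mul fun s t => ?_
    rw [Real.coe_toNNReal _ (abs_nonneg _), Real.dist_eq, Real.dist_eq, ← abs_neg (s - t), ← abs_mul]
    refine le_of_eq (congrArg _ ?_)
    ring
  have h3 : LipschitzWith (Real.toNNReal |1 / d|) fun t : ℝ => max 0 (min (-t / d - m) k) :=
    (h2.min_const k).const_max 0
  have h4 := (LipschitzWith.const' (α := ℝ) (1 : ℝ) (K := 0)).sub
    (lipschitzOnWith_univ.1 (h1.comp h3.lipschitzOnWith fun t _ => Set.mem_Ici.2 (le_max_left _ _)))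
  exact ⟨_, h4⟩

/-- The function is constant for -t/d - m ≤ 0 and, thanks to the cut at k, for -t/d - m ≥ k, which
confines its derivative to a compact interval. -/
theorem isRenormalizer_damping (hε : 0 < ε) (hd : 0 < d) (hk : 0 ≤ k) :
    IsRenormalizer (damping ε d m k) where
  bounded := ⟨1, fun t => by
    rw [abs_of_nonneg (damping_nonneg hε t)]; exact damping_le_one t⟩
  lipschitz := exists_lipschitzWith_damping hε
  compact_deriv := by
    refine HasCompactSupport.intro (isCompact_Icc (a := -(d * (m + k))) (b := -(d * m)))
      fun t ht => ?_
    have hc : Continuous fun t : ℝ => -t / d - m := by fun_prop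
    rw [Set.mem_Icc, not_and_or, not_le, not_le] at ht
    rcases ht with ht | ht
    · have h1 : k < -t / d - m := by
        rw [lt_sub_iff_add_lt, lt_div_iff₀ hd]; linarith
      have e : damping ε d m k =ᶠ[𝓝 t] fun _ => 1 - (1 + k) ^ (-ε) := by
        filter_upwards [hc.continuousAt.eventually_const_lt h1] with s hs
        exact damping_of_le hk hs.le
      rw [e.deriv_eq, deriv_const]
    · have h1 : -t / d - m < 0 := by
        rw [sub_lt_zero, div_lt_iff₀ hd]; linarith
      have e : damping ε d m k =ᶠ[𝓝 t] fun _ => 0 := by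
        filter_upwards [hc.continuousAt.eventually_lt_const h1] with s hs
        exact damping_of_nonpos hs.le
      rw [e.deriv_eq, deriv_const]

theorem tendsto_damping_atTop (hd : 0 < d) : Tendsto (damping ε d m k) atTop (𝓝 0) := by
  refine tendsto_const_nhds.congr' ?_
  filter_upwards [eventually_ge_atTop (-(d * m))] with t ht
  refine (damping_of_nonpos ?_).symm
  rw [sub_nonpos, div_le_iff₀ hd]; linarith

theorem tendsto_damping_atBot (hd : 0 < d) (hk : 0 ≤ k) :
    Tendsto (damping ε d m k) atBot (𝓝 (1 - (1 + k) ^ (-ε))) := by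
  refine tendsto_const_nhds.congr' ?_
  filter_upwards [eventually_le_atBot (-(d * (m + k)))] with t ht
  refine (damping_of_le hk ?_).symm
  rw [le_sub_iff_add_le, le_div_iff₀ hd]; linarith

end damping

/-! ### Supersolutions and the Caccioppoli inequality -/

/-- A real valued function that satisfies the renormalized equation as an inequality. -/
structure IsRealSupersolution (p q : ℝ) (Ω : Set (E n)) (u : E n → ℝ) (Z : E n → E n) : Prop where
  measurable_fun : Measurable u
  measurable_grad : Measurable Z
  weakGradient_trunc : ∀ k : ℝ, 0 < k →
    IsWeakGradient Ω (fun x => max (-k) (min k (u x))) ({x | |u x| < k}.indicator Z)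
  nonneg : ∀ h : ℝ → ℝ, IsRenormalizer h → (∀ t, 0 ≤ h t) → (∃ a, Tendsto h atTop (𝓝 a)) →
    (∃ a, Tendsto h atBot (𝓝 a)) → ∀ φ : E n → ℝ, IsTest Ω φ → (∀ x, 0 ≤ φ x) →
    IntegrableOn (fun x => (‖Z x‖ ^ p + ‖Z x‖ ^ q) * deriv h (u x) * φ x) Ω ∧
    IntegrableOn (fun x => inner ℝ (flux p q (Z x)) (gradient φ x) * h (u x)) Ω ∧
    0 ≤ (∫ x in Ω, (‖Z x‖ ^ p + ‖Z x‖ ^ q) * deriv h (u x) * φ x) +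
        ∫ x in Ω, inner ℝ (flux p q (Z x)) (gradient φ x) * h (u x)

theorem norm_flux_le {p q : ℝ} (hp : 1 < p) (hq : 1 < q) (ξ : E n) :
    ‖flux p q ξ‖ ≤ ‖ξ‖ ^ (p - 1) + ‖ξ‖ ^ (q - 1) := by
  have h (r : ℝ) (hr : 1 < r) : ‖‖ξ‖ ^ (r - 2) • ξ‖ = ‖ξ‖ ^ (r - 1) := by
    rw [norm_smul, Real.norm_of_nonneg (by positivity)]
    rcases (norm_nonneg ξ).eq_or_lt with h0 | h0
    · rw [← h0, mul_zero, Real.zero_rpow (by linarith)]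
    · rw [← Real.rpow_add_one h0.ne']; ring_nf
  refine (norm_add_le _ _).trans ?_
  rw [h p hp, h q hq]

theorem IsTest.pow {Ω : Set (E n)} {η : E n → ℝ} (hη : IsTest Ω η) {N : ℕ} (hN : N ≠ 0) :
    IsTest Ω fun x => η x ^ N := by
  have h : tsupport (fun x => η x ^ N) ⊆ tsupport η :=
    closure_mono fun x hx h0 => hx (by simp [h0, hN])
  exact ⟨hη.smooth.pow N, hη.compact.isCompact.of_isClosed_subset (isClosed_tsupport _) h,
    h.trans hη.support⟩

theorem norm_gradient (φ : E n → ℝ) (x : E n) : ‖gradient φ x‖ = ‖fderiv ℝ φ x‖ := by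
  rw [gradient, LinearIsometryEquiv.norm_map]

theorem IsTest.norm_gradient_pow {Ω : Set (E n)} {η : E n → ℝ} (hη : IsTest Ω η) (N : ℕ)
    (x : E n) : ‖gradient (fun x => η x ^ N) x‖ = N * |η x| ^ (N - 1) * ‖gradient η x‖ := by
  rw [norm_gradient, norm_gradient]
  rw [fderiv_fun_pow N (hη.smooth.differentiable (by simp) x), norm_smul]
  simp

theorem isRenormalizer_one : IsRenormalizer fun _ => (1 : ℝ) where
  bounded := ⟨1, fun t => by simp⟩
  lipschitz := ⟨0, LipschitzWith.const 1⟩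
  compact_deriv := by
    simp only [deriv_const']
    exact HasCompactSupport.zero

/-- The Caccioppoli inequality for the superlevel set `{-u / d > m}`. -/
theorem IsRealSupersolution.caccioppoli {p q : ℝ} (hp : 1 < p) (hpq : p ≤ q) (hqn : q ≤ n)
    {Ω : Set (E n)} (hΩ : IsOpen Ω) {u : E n → ℝ} {Z : E n → E n}
    (hu : IsRealSupersolution p q Ω u Z) {ε : ℝ} (hε : 0 < ε) (hε1 : ε ≤ 1) {d m M : ℝ}
    (hd : 1 ≤ d) (hM : 1 ≤ M) {η : E n → ℝ} (hη : IsTest Ω η) (hη0 : ∀ x, 0 ≤ η x)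
    (hη1 : ∀ x, η x ≤ 1) (hηM : ∀ x, ‖gradient η x‖ ≤ M) :
    ∫⁻ x in Ω ∩ {x | 0 < -u x / d - m}, ENNReal.ofReal
        ((‖Z x‖ / d) ^ q * (1 + (-u x / d - m)) ^ (-1 - ε) * η x ^ n) ≤
      ENNReal.ofReal (4 / ε * (n * M) ^ q * (2 / ε) ^ (q - 1)) *
        ∫⁻ x in (Ω ∩ {x | 0 < -u x / d - m}) ∩ {x | 0 < η x},
          ENNReal.ofReal ((1 + (-u x / d - m)) ^ ((1 + ε) * (q - 1))) := by
  have hq : 1 < q := hp.trans_le hpq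
  have hd0 : 0 < d := by linarith
  have hn : n ≠ 0 := by rintro rfl; norm_num at hqn; linarith
  have hn1 : n - 1 ≠ 0 := by
    intro h
    have : n = 1 := by omega
    subst this; norm_num at hqn; linarith
  set y : E n → ℝ := fun x => -u x / d - m with hy
  have hym : Measurable y := (hu.measurable_fun.neg.div_const d).sub_const m
  set A : Set (E n) := Ω ∩ {x | 0 < y x} with hA
  have hAm : MeasurableSet A := hΩ.measurableSet.inter (measurableSet_lt measurable_const hym)
  have hηm : Measurable η := hη.smooth.continuous.measurable
  have hφ : IsTest Ω fun x => η x ^ n := hη.pow hn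
  have hφ0 : ∀ x, 0 ≤ η x ^ n := fun x => pow_nonneg (hη0 x) n
  set G : E n → ℝ := fun x =>
    (‖Z x‖ ^ p + ‖Z x‖ ^ q) * (ε / d * (1 + y x) ^ (-1 - ε)) * η x ^ n with hG
  have hZm := hu.measurable_grad.norm
  have hGm : Measurable G := ((hZm.pow_const p).add (hZm.pow_const q)).mul
    (measurable_const.mul ((hym.const_add 1).pow_const _)) |>.mul (hηm.pow_const n)
  set I : E n → ℝ := fun x => inner ℝ (flux p q (Z x)) (gradient (fun x => η x ^ n) x) with hI
  have hIint : IntegrableOn I Ω := by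
    have := (hu.nonneg _ isRenormalizer_one (fun _ => zero_le_one) ⟨1, tendsto_const_nhds⟩
      ⟨1, tendsto_const_nhds⟩ _ hφ hφ0).2.1
    simpa only [mul_one] using this
  -- Finite by the equation with h = 1. It bounds the energy uniformly in k, so the energy is finite
  -- and half of it can be absorbed below.
  set J : ℝ≥0∞ := ∫⁻ x in A, ENNReal.ofReal |I x| with hJ
  have hJfin : J ≠ ⊤ := by
    have h1 : ∫⁻ x in Ω, ENNReal.ofReal |I x| < ⊤ := by
      have := hIint.2
      rw [hasFiniteIntegral_iff_norm] at this
      exact this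
    exact ((lintegral_mono_set Set.inter_subset_left).trans_lt h1).ne
  -- the truncated estimate
  have htr : ∀ k : ℕ, ∫⁻ x in A ∩ {x | y x < k}, ENNReal.ofReal (G x) ≤ J := by
    intro k
    have hk : (0 : ℝ) ≤ k := Nat.cast_nonneg k
    obtain ⟨i1, i2, i3⟩ := hu.nonneg (damping ε d m k) (isRenormalizer_damping hε hd0 hk)
      (damping_nonneg hε) ⟨_, tendsto_damping_atTop hd0⟩ ⟨_, tendsto_damping_atBot hd0 hk⟩ _ hφ hφ0
    set h := damping ε d m k
    -- Monotonicity covers the kinks as well, where `deriv` may take its default value 0; the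
    -- explicit derivative is needed only for 0 < y < k.
    have hh' : ∀ t, deriv h t ≤ 0 := fun t => (antitone_damping hε hd0).deriv_nonpos
    have i1' := i1.neg
    calc ∫⁻ x in A ∩ {x | y x < k}, ENNReal.ofReal (G x)
        = ∫⁻ x in A ∩ {x | y x < k}, ENNReal.ofReal
            (-((‖Z x‖ ^ p + ‖Z x‖ ^ q) * deriv h (u x) * η x ^ n)) := by
          refine setLIntegral_congr_fun (hAm.inter (measurableSet_lt hym measurable_const))
            fun x hx => ?_
          have : deriv h (u x) = _ := (hasDerivAt_damping hd0 hx.1.2 hx.2).deriv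
          simp only [hG]
          rw [this]
          congr 1
          simp only [hy]
          ring
      _ ≤ ∫⁻ x in Ω, ENNReal.ofReal (-((‖Z x‖ ^ p + ‖Z x‖ ^ q) * deriv h (u x) * η x ^ n)) :=
          lintegral_mono_set (Set.inter_subset_left.trans Set.inter_subset_left)
      _ = ENNReal.ofReal (∫ x in Ω, -((‖Z x‖ ^ p + ‖Z x‖ ^ q) * deriv h (u x) * η x ^ n)) := by
          refine (ofReal_integral_eq_lintegral_ofReal i1' (Eventually.of_forall fun x => ?_)).symm
          have h1 : 0 ≤ (‖Z x‖ ^ p + ‖Z x‖ ^ q) := by positivity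
          have h2 := mul_nonpos_of_nonpos_of_nonneg
            (mul_nonpos_of_nonneg_of_nonpos h1 (hh' (u x))) (hφ0 x)
          simpa using h2
      _ ≤ ENNReal.ofReal (∫ x in Ω, I x * h (u x)) := by
          refine ENNReal.ofReal_le_ofReal ?_
          rw [integral_neg]
          linarith
      _ ≤ ∫⁻ x in Ω, ENNReal.ofReal |I x * h (u x)| := by
          refine (ENNReal.ofReal_le_ofReal (le_abs_self _)).trans ?_
          have := enorm_integral_le_lintegral_enorm (μ := volume.restrict Ω)
            (fun x => I x * h (u x))
          simpa only [Real.enorm_eq_ofReal_abs] using this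
      _ ≤ ∫⁻ x in Ω, A.indicator (fun x => ENNReal.ofReal |I x|) x := by
          refine setLIntegral_mono' hΩ.measurableSet fun x hxΩ => ?_
          by_cases hx : x ∈ A
          · rw [Set.indicator_of_mem hx, abs_mul, abs_of_nonneg (damping_nonneg hε _)]
            exact ENNReal.ofReal_le_ofReal
              (mul_le_of_le_one_right (abs_nonneg _) (damping_le_one _))
          · have h0 : h (u x) = 0 := damping_of_nonpos (by
              by_contra hc
              exact hx ⟨hxΩ, not_le.1 hc⟩)
            simp [h0]
      _ = J := by
          rw [setLIntegral_indicator hAm, Set.inter_eq_left.2 Set.inter_subset_left]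
  have hLJ : ∫⁻ x in A, ENNReal.ofReal (G x) ≤ J := by
    have hU : A = ⋃ k : ℕ, A ∩ {x | y x < k} := by
      rw [← Set.inter_iUnion, Set.left_eq_inter]
      intro x _
      obtain ⟨k, hk⟩ := exists_nat_gt (y x)
      exact Set.mem_iUnion.2 ⟨k, hk⟩
    rw [hU, setLIntegral_iUnion_of_directed]
    · exact iSup_le htr
    · refine directed_of_isDirected_le fun i j hij => ?_
      refine Set.inter_subset_inter_right _ fun x hx => ?_
      have : (i : ℝ) ≤ j := by exact_mod_cast hij
      exact lt_of_lt_of_le hx this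
  set c : ℝ := (n * M) ^ q * (2 * d / ε) ^ (q - 1) with hc
  have hc0 : 0 ≤ c := by positivity
  set R : ℝ≥0∞ := ∫⁻ x in A ∩ {x | 0 < η x},
    ENNReal.ofReal ((1 + y x) ^ ((1 + ε) * (q - 1))) with hR
  -- Where η = 0 the left side vanishes because n - 1 ≠ 0. Hence the remainder lives on {η > 0}, the
  -- localization that the iteration needs.
  have hpt : ∀ x ∈ A, |I x| ≤ 1 / 2 * G x +
      {x | 0 < η x}.indicator (fun x => 2 * c * (1 + y x) ^ ((1 + ε) * (q - 1))) x := by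
    intro x hx
    have hS : 1 ≤ 1 + y x := by have : 0 < y x := hx.2; linarith
    have h1 : |I x| ≤ (‖Z x‖ ^ (p - 1) + ‖Z x‖ ^ (q - 1)) * (n * η x ^ (n - 1) * M) := by
      refine (abs_real_inner_le_norm _ _).trans ?_
      rw [hη.norm_gradient_pow, abs_of_nonneg (hη0 x)]
      have := norm_flux_le hp hq (Z x)
      have h2 := hηM x
      have h3 := hη0 x
      gcongr
    refine h1.trans ?_
    rcases (hη0 x).eq_or_lt with h0 | h0
    · simp [hG, ← h0, hn, hn1]
    · rw [Set.indicator_of_mem (show x ∈ {x | 0 < η x} from h0)]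
      have a1 := rpow_mul_pow_le (z := ‖Z x‖) hp hpq hqn hε hε1 (norm_nonneg _) (hη0 x) (hη1 x)
        hM hd hS
      have a2 := rpow_mul_pow_le (z := ‖Z x‖) hq le_rfl hqn hε hε1 (norm_nonneg _) (hη0 x) (hη1 x)
        hM hd hS
      simp only [hG, hc]
      linarith
  have hJL : J ≤ ENNReal.ofReal (1 / 2) * (∫⁻ x in A, ENNReal.ofReal (G x)) +
      ENNReal.ofReal (2 * c) * R := by
    have hRm : Measurable fun x => (1 + y x) ^ ((1 + ε) * (q - 1)) :=
      (hym.const_add 1).pow_const _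
    have hηs : MeasurableSet {x | 0 < η x} := measurableSet_lt measurable_const hηm
    rw [hR, ← lintegral_const_mul _ hGm.ennreal_ofReal, Set.inter_comm A, ← setLIntegral_indicator hηs,
      ← lintegral_const_mul _ (hRm.ennreal_ofReal.indicator hηs),
      ← lintegral_add_left (hGm.ennreal_ofReal.const_mul _)]
    refine setLIntegral_mono' hAm fun x hx => ?_
    refine (ENNReal.ofReal_le_ofReal (hpt x hx)).trans ?_
    refine ENNReal.ofReal_add_le.trans ?_
    rw [ENNReal.ofReal_mul (by norm_num)]
    gcongr
    by_cases h0 : x ∈ {x | 0 < η x}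
    · rw [Set.indicator_of_mem h0, Set.indicator_of_mem h0, ENNReal.ofReal_mul (by positivity)]
    · rw [Set.indicator_of_notMem h0, Set.indicator_of_notMem h0]
      simp
  set L : ℝ≥0∞ := ∫⁻ x in A, ENNReal.ofReal (G x) with hL
  have hLfin : L ≠ ⊤ := ne_top_of_le_ne_top hJfin hLJ
  have hL4 : L ≤ ENNReal.ofReal (4 * c) * R := by
    have h1 : L ≤ ENNReal.ofReal (1 / 2) * L + ENNReal.ofReal (2 * c) * R := hLJ.trans hJL
    have h2 : L = ENNReal.ofReal (1 / 2) * L + ENNReal.ofReal (1 / 2) * L := by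
      rw [← add_mul, ← ENNReal.ofReal_add (by norm_num) (by norm_num)]
      norm_num
    have h3 : ENNReal.ofReal (1 / 2) * L ≤ ENNReal.ofReal (2 * c) * R := by
      rw [← ENNReal.add_le_add_iff_left (ENNReal.mul_ne_top ENNReal.ofReal_ne_top hLfin), ← h2]
      exact h1
    calc L = ENNReal.ofReal 2 * (ENNReal.ofReal (1 / 2) * L) := by
          rw [← mul_assoc, ← ENNReal.ofReal_mul (by norm_num)]; norm_num
      _ ≤ ENNReal.ofReal 2 * (ENNReal.ofReal (2 * c) * R) := by gcongr
      _ = ENNReal.ofReal (4 * c) * R := by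
          rw [← mul_assoc, ← ENNReal.ofReal_mul (by norm_num)]; ring_nf
  have hd1 : 0 < d ^ (q - 1) := by positivity
  calc ∫⁻ x in A, ENNReal.ofReal ((‖Z x‖ / d) ^ q * (1 + y x) ^ (-1 - ε) * η x ^ n)
      ≤ ∫⁻ x in A, ENNReal.ofReal (1 / (ε * d ^ (q - 1))) * ENNReal.ofReal (G x) := by
        refine setLIntegral_mono' hAm fun x hx => ?_
        rw [← ENNReal.ofReal_mul (by positivity)]
        refine ENNReal.ofReal_le_ofReal ?_
        have hS : 0 < 1 + y x := by have : 0 < y x := hx.2; linarith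
        have e : (‖Z x‖ / d) ^ q * (1 + y x) ^ (-1 - ε) * η x ^ n =
            1 / (ε * d ^ (q - 1)) * (‖Z x‖ ^ q * (ε / d * (1 + y x) ^ (-1 - ε)) * η x ^ n) := by
          have e1 : d ^ q = d ^ (q - 1) * d := by
            rw [← Real.rpow_add_one hd0.ne']; ring_nf
          rw [Real.div_rpow (norm_nonneg _) hd0.le, e1]
          field_simp
        rw [e]
        have h1 : 0 ≤ ‖Z x‖ ^ p := by positivity
        have h2 := hη0 x
        simp only [hG]
        gcongr
        linarith
    _ = ENNReal.ofReal (1 / (ε * d ^ (q - 1))) * L := lintegral_const_mul _ hGm.ennreal_ofReal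
    _ ≤ ENNReal.ofReal (1 / (ε * d ^ (q - 1))) * (ENNReal.ofReal (4 * c) * R) := by gcongr
    _ = _ := by
        rw [← mul_assoc, ← ENNReal.ofReal_mul (by positivity)]
        congr 2
        -- The power d^(q-1) from Young's inequality cancels against the rescaling of the energy,
        -- leaving a constant free of d.
        have e2 : (2 * d / ε) ^ (q - 1) = (2 / ε) ^ (q - 1) * d ^ (q - 1) := by
          rw [← Real.mul_rpow (by positivity) hd0.le]; ring_nf
        rw [hc, e2]
        field_simp

/-! ### Gain of integrability -/

theorem holderConjugate_div_sub_one (hn : (1 : ℝ) < n) :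
    Real.HolderConjugate (n : ℝ) (n / (n - 1)) := Real.HolderConjugate.conjExponent hn

/-- The gain of integrability that results from the Caccioppoli and Sobolev inequalities. -/
theorem IsRealSupersolution.lintegral_profile_le {p q : ℝ} (hp : 1 < p) (hpq : p ≤ q) (hqn : q ≤ n)
    {Ω : Set (E n)} (hΩ : IsOpen Ω) {u : E n → ℝ} {Z : E n → E n}
    (hu : IsRealSupersolution p q Ω u Z) {ε κ : ℝ} (hε : 0 < ε) (hε1 : ε ≤ 1)
    (hκ : κ - 1 ≤ (1 + ε) * (q - 2)) (hκ0 : 0 ≤ κ) (hκσ : κ ≤ (1 + ε) * (q - 1)) :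
    ∃ C : ℝ, 0 < C ∧ ∀ d m M : ℝ, 1 ≤ d → 0 ≤ m → 1 ≤ M → ∀ η : E n → ℝ, IsTest Ω η →
      (∀ x, 0 ≤ η x) → (∀ x, η x ≤ 1) → (∀ x, ‖gradient η x‖ ≤ M) →
      ∫⁻ x, ‖profile κ (-u x / d - m) * η x ^ n‖ₑ ^ ((n : ℝ) / (n - 1)) ≤
        (ENNReal.ofReal (C * M ^ q) * ∫⁻ x in (Ω ∩ {x | 0 < -u x / d - m}) ∩ {x | 0 < η x},
          ENNReal.ofReal ((1 + (-u x / d - m)) ^ ((1 + ε) * (q - 1)))) ^ ((n : ℝ) / (n - 1)) := by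
  have hq : 1 < q := hp.trans_le hpq
  have hn1 : (1 : ℝ) < n := hq.trans_le hqn
  have hn : n ≠ 0 := by rintro rfl; norm_num at hn1
  have hnn : n - 1 ≠ 0 := by
    intro h
    have : n = 1 := by omega
    subst this; norm_num at hn1
  have hconj := holderConjugate_div_sub_one hn1
  set p' : ℝ := (n : ℝ) / (n - 1)
  have hp'0 : 0 < p' := hconj.symm.pos
  set σ := (1 + ε) * (q - 1)
  set CS := lintegralPowLePowLIntegralFDerivConst (volume : Measure (E n)) p'
  set Ck : ℝ := 2 + |κ - 2|
  have hCk : 0 < Ck := by positivity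
  set Cc : ℝ := 4 / ε * n ^ q * (2 / ε) ^ (q - 1)
  have hCc : 0 ≤ Cc := by positivity
  set C1 : ℝ := Ck * (Cc + 1) + n with hC1
  have hC1p : 0 < C1 := by positivity
  -- Moves the Sobolev constant inside the power p'; the 1 keeps s positive.
  set s : ℝ := (CS : ℝ) ^ p'⁻¹ + 1
  have hs : 0 < s := by positivity
  have hsC : (CS : ℝ≥0∞) ≤ ENNReal.ofReal s ^ p' := by
    rw [ENNReal.ofReal_rpow_of_pos hs, ← ENNReal.ofReal_coe_nnreal]
    refine ENNReal.ofReal_le_ofReal ?_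
    calc (CS : ℝ) = ((CS : ℝ) ^ p'⁻¹) ^ p' := (Real.rpow_inv_rpow CS.coe_nonneg hp'0.ne').symm
      _ ≤ s ^ p' := Real.rpow_le_rpow (by positivity) (by simp [s]) hp'0.le
  refine ⟨s * C1, by positivity, fun d m M hd hm hM η hη hη0 hη1 hηM => ?_⟩
  have hd0 : 0 < d := by linarith
  set y : E n → ℝ := fun x => -u x / d - m with hy
  have hym : Measurable y := (hu.measurable_fun.neg.div_const d).sub_const m
  have hηm : Measurable η := hη.smooth.continuous.measurable
  set A : Set (E n) := Ω ∩ {x | 0 < y x} with hA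
  have hAm : MeasurableSet A := hΩ.measurableSet.inter (measurableSet_lt measurable_const hym)
  have hηs : MeasurableSet {x | 0 < η x} := measurableSet_lt measurable_const hηm
  set R : ℝ≥0∞ := ∫⁻ x in A ∩ {x | 0 < η x}, ENNReal.ofReal ((1 + y x) ^ σ) with hR
  have hφ : IsTest Ω fun x => η x ^ n := hη.pow hn
  have hφ0 : ∀ x, 0 ≤ η x ^ n := fun x => pow_nonneg (hη0 x) n
  have hφ1 : ∀ x, η x ^ n ≤ 1 := fun x => pow_le_one₀ (hη0 x) (hη1 x)
  set g : ℝ → ℝ := fun t => profile κ (-t / d - m) with hg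
  have hgd : ∀ t, HasDerivAt g (profileDeriv κ (-t / d - m) * (-1 / d)) t := fun t =>
    (hasDerivAt_profile κ _).comp t (((hasDerivAt_id t).neg.div_const d).sub_const m)
  have hgc : ContDiff ℝ 1 g :=
    (contDiff_profile κ).comp ((contDiff_id.neg.div_const d).sub contDiff_const)
  have hMq : M ≤ M ^ q := Real.self_le_rpow_of_one_le hM hq.le
  have hMq1 : 1 ≤ M ^ q := hM.trans hMq
  set D : ℝ≥0∞ := ENNReal.ofReal (C1 * M ^ q) * R with hD
  have hcacc : ∫⁻ x in A, ENNReal.ofReal ((‖Z x‖ / d) ^ q * (1 + y x) ^ (-1 - ε) * η x ^ n) ≤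
      ENNReal.ofReal (Cc * M ^ q) * R := by
    have := hu.caccioppoli hp hpq hqn hΩ hε hε1 (m := m) hd hM hη hη0 hη1 hηM
    refine this.trans (le_of_eq ?_)
    congr 2
    rw [Real.mul_rpow (by positivity) (by positivity)]
    ring
  -- the estimate for the truncations
  have htr : ∀ k : ℕ, ∫⁻ x, ‖g (max (-(k + 1 : ℝ)) (min (k + 1 : ℝ) (u x))) * η x ^ n‖ₑ ^ p' ≤
      (ENNReal.ofReal s * D) ^ p' := by
    intro k
    have hk : (0 : ℝ) < k + 1 := by positivity
    set f : E n → ℝ := fun x => max (-(k + 1 : ℝ)) (min (k + 1 : ℝ) (u x)) with hf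
    have hfk : ∀ x, |f x| ≤ k + 1 := fun x =>
      abs_le.2 ⟨le_max_left _ _, max_le (by linarith) (min_le_left _ _)⟩
    -- Since m ≥ 0, the left side is positive only where f < 0, and there the truncation can only
    -- raise u.
    have hfy : ∀ x, 0 < -f x / d - m → -f x / d - m ≤ y x := by
      intro x hx
      have h1 : f x < 0 := by
        by_contra hc
        have : -f x / d ≤ 0 := div_nonpos_of_nonpos_of_nonneg (by linarith) hd0.le
        linarith
      have h2 : u x ≤ f x := by
        rcases le_total (u x) (k + 1) with h | h
        · rw [hf]; simp [min_eq_right h]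
        · exfalso
          have : f x = k + 1 := by
            simp only [hf, min_eq_left h]
            exact max_eq_right (by linarith)
          linarith
      simp only [hy]
      gcongr
    have hsob := lintegral_comp_mul_rpow_le hconj hΩ (hu.weakGradient_trunc (k + 1) hk) hfk hgc hφ
    refine hsob.trans ?_
    rw [ENNReal.mul_rpow_of_nonneg _ _ hp'0.le]
    refine mul_le_mul' hsC (ENNReal.rpow_le_rpow ?_ hp'0.le)
    have hGm : Measurable fun x => (‖Z x‖ / d) ^ q * (1 + y x) ^ (-1 - ε) * η x ^ n :=
      (((hu.measurable_grad.norm.div_const d).pow_const q).mul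
        ((hym.const_add 1).pow_const _)).mul (hηm.pow_const n)
    have hSm : Measurable fun x => (1 + y x) ^ σ := (hym.const_add 1).pow_const _
    -- The gradient of the profile is split by `mul_rpow_le_rpow_mul_add` into the Caccioppoli
    -- energy and (1 + y)^σ.
    have i1 : ∫⁻ x in Ω, ‖η x ^ n‖ₑ * ‖deriv g (f x)‖ₑ *
        ‖{x | |u x| < (k : ℝ) + 1}.indicator Z x‖ₑ ≤ ENNReal.ofReal (Ck * (Cc + 1) * M ^ q) * R := by
      calc _ ≤ ∫⁻ x in Ω, A.indicator (fun x => ENNReal.ofReal Ck *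
            (ENNReal.ofReal ((‖Z x‖ / d) ^ q * (1 + y x) ^ (-1 - ε) * η x ^ n) +
              {x | 0 < η x}.indicator (fun x => ENNReal.ofReal ((1 + y x) ^ σ)) x)) x := by
            refine setLIntegral_mono' hΩ.measurableSet fun x hxΩ => ?_
            by_cases hxk : |u x| < (k : ℝ) + 1
            swap
            · rw [Set.indicator_of_notMem (show x ∉ {x | |u x| < (k : ℝ) + 1} from hxk)]
              simp
            rw [Set.indicator_of_mem (show x ∈ {x | |u x| < (k : ℝ) + 1} from hxk)]
            have hfu : f x = u x := by
              have := abs_lt.1 hxk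
              simp only [hf]
              rw [min_eq_right this.2.le, max_eq_right this.1.le]
            rw [hfu, (hgd _).deriv]
            by_cases hx : x ∈ A
            swap
            · have : profileDeriv κ (-u x / d - m) = 0 := profileDeriv_of_nonpos (by
                by_contra hc
                exact hx ⟨hxΩ, not_le.1 hc⟩)
              simp [this]
            rw [Set.indicator_of_mem hx]
            rcases (hη0 x).eq_or_lt with h0 | h0
            · simp [← h0, hn]
            rw [Set.indicator_of_mem (show x ∈ {x | 0 < η x} from h0)]
            have hy0 : 0 < y x := hx.2
            have hS1 : 1 ≤ 1 + y x := by linarith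
            rw [← ENNReal.ofReal_add (by positivity) (by positivity),
              ← ENNReal.ofReal_mul hCk.le, Real.enorm_eq_ofReal_abs, Real.enorm_eq_ofReal_abs,
              ← ofReal_norm (Z x), ← ENNReal.ofReal_mul (abs_nonneg _),
              ← ENNReal.ofReal_mul (by positivity)]
            refine ENNReal.ofReal_le_ofReal ?_
            have a1 := abs_profileDeriv_le (κ := κ) hy0.le
            have a2 := mul_rpow_le_rpow_mul_add (w := ‖Z x‖ / d) hq hκ (by positivity) hS1
            have e1 : |(-1 : ℝ) / d| = 1 / d := by rw [abs_div, abs_neg, abs_one, abs_of_pos hd0]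
            rw [abs_of_nonneg (hφ0 x), abs_mul, e1]
            calc η x ^ n * (|profileDeriv κ (-u x / d - m)| * (1 / d)) * ‖Z x‖
                ≤ η x ^ n * ((Ck * (1 + y x) ^ (κ - 1)) * (1 / d)) * ‖Z x‖ := by
                  have := hφ0 x
                  gcongr
              _ = Ck * (η x ^ n * (‖Z x‖ / d * (1 + y x) ^ (κ - 1))) := by ring
              _ ≤ Ck * (η x ^ n * ((‖Z x‖ / d) ^ q * (1 + y x) ^ (-1 - ε) + (1 + y x) ^ σ)) := by
                  have := hφ0 x
                  gcongr
              _ ≤ Ck * ((‖Z x‖ / d) ^ q * (1 + y x) ^ (-1 - ε) * η x ^ n + (1 + y x) ^ σ) := by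
                  gcongr
                  have h5 : η x ^ n * (1 + y x) ^ σ ≤ (1 + y x) ^ σ :=
                    mul_le_of_le_one_left (by positivity) (hφ1 x)
                  linarith
        _ = ENNReal.ofReal Ck *
              (∫⁻ x in A, ENNReal.ofReal ((‖Z x‖ / d) ^ q * (1 + y x) ^ (-1 - ε) * η x ^ n)) +
              ENNReal.ofReal Ck * R := by
            have hm2 : Measurable fun x =>
                ENNReal.ofReal ((‖Z x‖ / d) ^ q * (1 + y x) ^ (-1 - ε) * η x ^ n) +
                {x | 0 < η x}.indicator (fun x => ENNReal.ofReal ((1 + y x) ^ σ)) x :=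
              hGm.ennreal_ofReal.add (hSm.ennreal_ofReal.indicator hηs)
            rw [setLIntegral_indicator hAm, Set.inter_eq_left.2 Set.inter_subset_left,
              lintegral_const_mul _ hm2,
              lintegral_add_left hGm.ennreal_ofReal, setLIntegral_indicator hηs, mul_add,
              Set.inter_comm {x | 0 < η x}]
        _ ≤ ENNReal.ofReal Ck * (ENNReal.ofReal (Cc * M ^ q) * R) +
              ENNReal.ofReal Ck * (ENNReal.ofReal (M ^ q) * R) := by
            gcongr
            refine le_mul_of_one_le_left' ?_
            rw [← ENNReal.ofReal_one]
            exact ENNReal.ofReal_le_ofReal hMq1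
        _ = _ := by
            rw [← mul_add, ← add_mul, ← ENNReal.ofReal_add (by positivity) (by positivity),
              ← mul_assoc, ← ENNReal.ofReal_mul hCk.le]
            ring_nf
    have i2 : ∫⁻ x in Ω, ‖g (f x)‖ₑ * ‖gradient (fun x => η x ^ n) x‖ₑ ≤
        ENNReal.ofReal (n * M ^ q) * R := by
      calc _ ≤ ∫⁻ x in Ω, (A ∩ {x | 0 < η x}).indicator (fun x => ENNReal.ofReal (n * M ^ q) *
            ENNReal.ofReal ((1 + y x) ^ σ)) x := by
            refine setLIntegral_mono' hΩ.measurableSet fun x hxΩ => ?_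
            rw [← ofReal_norm (gradient _ _), hη.norm_gradient_pow]
            rcases (hη0 x).eq_or_lt with h0 | h0
            · simp [← h0, hnn]
            by_cases hx : 0 < -f x / d - m
            swap
            · simp [hg, profile_of_nonpos (not_lt.1 hx)]
            have h1 := hfy x hx
            have hxA : x ∈ A ∩ {x | 0 < η x} := ⟨⟨hxΩ, hx.trans_le h1⟩, h0⟩
            have hS1 : 1 ≤ 1 + y x := by linarith
            rw [Set.indicator_of_mem hxA, Real.enorm_eq_ofReal_abs,
              ← ENNReal.ofReal_mul (abs_nonneg _), ← ENNReal.ofReal_mul (by positivity)]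
            refine ENNReal.ofReal_le_ofReal ?_
            rw [abs_of_nonneg (profile_nonneg _ _), mul_comm]
            have h2 : g (f x) ≤ (1 + y x) ^ σ := by
              refine (profile_le hx.le).trans ?_
              refine (Real.rpow_le_rpow (by linarith) (add_le_add_right h1 1) hκ0).trans ?_
              exact Real.rpow_le_rpow_of_exponent_le hS1 hκσ
            have h3 : n * |η x| ^ (n - 1) * ‖gradient η x‖ ≤ n * M ^ q := by
              calc n * |η x| ^ (n - 1) * ‖gradient η x‖ ≤ n * 1 * M ^ q := by
                    have h4 : |η x| ^ (n - 1) ≤ 1 :=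
                      pow_le_one₀ (abs_nonneg _) (by rw [abs_of_pos h0]; exact hη1 x)
                    have h5 := (hηM x).trans hMq
                    gcongr
                _ = n * M ^ q := by ring
            exact mul_le_mul h3 h2 (profile_nonneg _ _) (by positivity)
        _ = _ := by
            rw [setLIntegral_indicator (hAm.inter hηs), Set.inter_eq_left.2
              (Set.inter_subset_left.trans Set.inter_subset_left),
              lintegral_const_mul _ hSm.ennreal_ofReal]
    refine (add_le_add i1 i2).trans (le_of_eq ?_)
    rw [← add_mul, ← ENNReal.ofReal_add (by positivity) (by positivity), hD, hC1]
    ring_nf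
  have hfin : (ENNReal.ofReal (s * C1 * M ^ q) * R) = ENNReal.ofReal s * D := by
    rw [hD, ← mul_assoc, ← ENNReal.ofReal_mul hs.le, mul_assoc s]
  rw [hfin]
  -- Fatou as k → ∞: at each point the truncations of u are eventually equal to u.
  calc ∫⁻ x, ‖profile κ (-u x / d - m) * η x ^ n‖ₑ ^ p'
      ≤ ∫⁻ x, liminf (fun k : ℕ =>
          ‖g (max (-(k + 1 : ℝ)) (min (k + 1 : ℝ) (u x))) * η x ^ n‖ₑ ^ p') atTop := by
        refine lintegral_mono fun x => ?_
        refine le_of_eq (Tendsto.liminf_eq ?_).symm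
        refine tendsto_const_nhds.congr' ?_
        obtain ⟨k0, hk0⟩ := exists_nat_gt |u x|
        filter_upwards [eventually_ge_atTop k0] with k hk
        have h1 : (k0 : ℝ) ≤ k := by exact_mod_cast hk
        have h2 := abs_lt.1 hk0
        rw [min_eq_right (by linarith), max_eq_right (by linarith)]
    _ ≤ liminf (fun k : ℕ => ∫⁻ x,
          ‖g (max (-(k + 1 : ℝ)) (min (k + 1 : ℝ) (u x))) * η x ^ n‖ₑ ^ p') atTop := by
        refine lintegral_liminf_le fun k => ?_
        exact (((hgc.continuous.measurable.comp
          (measurable_const.max (measurable_const.min hu.measurable_fun))).mul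
          (hηm.pow_const n)).enorm.pow_const _)
    _ ≤ liminf (fun _ : ℕ => (ENNReal.ofReal s * D) ^ p') atTop :=
        liminf_le_liminf (Eventually.of_forall htr)
    _ = _ := liminf_const _

/-! ### Cut-off functions and the De Giorgi iteration -/

theorem exists_abs_deriv_smoothTransition_le :
    ∃ B : ℝ, 0 ≤ B ∧ ∀ x, |deriv Real.smoothTransition x| ≤ B := by
  have hs : ContDiff ℝ 1 Real.smoothTransition := Real.smoothTransition.contDiff (n := 1)
  have hc : HasCompactSupport (deriv Real.smoothTransition) := by
    refine HasCompactSupport.intro (isCompact_Icc (a := (0 : ℝ)) (b := 1)) fun x hx => ?_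
    rw [Set.mem_Icc, not_and_or, not_le, not_le] at hx
    rcases hx with hx | hx
    · have e : Real.smoothTransition =ᶠ[𝓝 x] fun _ => 0 := by
        filter_upwards [Iio_mem_nhds hx] with t ht
        exact Real.smoothTransition.zero_of_nonpos (Set.mem_Iio.1 ht).le
      rw [e.deriv_eq, deriv_const]
    · have e : Real.smoothTransition =ᶠ[𝓝 x] fun _ => 1 := by
        filter_upwards [Ioi_mem_nhds hx] with t ht
        exact Real.smoothTransition.one_of_one_le (Set.mem_Ioi.1 ht).le
      rw [e.deriv_eq, deriv_const]
  obtain ⟨B, hB⟩ := hc.exists_bound_of_continuous (hs.continuous_deriv le_rfl)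
  exact ⟨B, (norm_nonneg _).trans (hB 0), hB⟩

/-- The cut-off function between the superlevel sets `{ψ > t}` and `{ψ ≥ t + τ}`. -/
theorem IsTest.smoothTransition {Ω : Set (E n)} {ψ : E n → ℝ} (hψ : IsTest Ω ψ) {t τ : ℝ}
    (ht : 0 ≤ t) (hτ : 0 < τ) : IsTest Ω fun x => Real.smoothTransition ((ψ x - t) / τ) := by
  have h : tsupport (fun x => Real.smoothTransition ((ψ x - t) / τ)) ⊆ tsupport ψ := by
    refine closure_mono fun x hx h0 => hx ?_
    refine Real.smoothTransition.zero_of_nonpos (div_nonpos_of_nonpos_of_nonneg ?_ hτ.le)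
    have : ψ x = 0 := h0
    linarith
  exact ⟨(Real.smoothTransition.contDiff (n := ⊤)).comp
      ((hψ.smooth.sub contDiff_const).div_const τ),
    hψ.compact.isCompact.of_isClosed_subset (isClosed_tsupport _) h, h.trans hψ.support⟩

theorem IsTest.norm_gradient_smoothTransition_le {Ω : Set (E n)} {ψ : E n → ℝ} (hψ : IsTest Ω ψ)
    {t τ B M : ℝ} (hτ : 0 < τ) (hB : ∀ x, |deriv Real.smoothTransition x| ≤ B)
    (hM : ∀ x, ‖gradient ψ x‖ ≤ M) (x : E n) :
    ‖gradient (fun x => Real.smoothTransition ((ψ x - t) / τ)) x‖ ≤ B * M / τ := by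
  have h0 : HasFDerivAt (fun x => (ψ x - t) * τ⁻¹) (τ⁻¹ • fderiv ℝ ψ x) x :=
    ((hψ.smooth.differentiable (by simp) x).hasFDerivAt.sub_const t).mul_const τ⁻¹
  have h1 : HasDerivAt Real.smoothTransition
      (deriv Real.smoothTransition ((ψ x - t) * τ⁻¹)) ((ψ x - t) * τ⁻¹) :=
    ((Real.smoothTransition.contDiff (n := 1)).differentiable (by simp) _).hasDerivAt
  have h2 := (h1.comp_hasFDerivAt x h0).fderiv
  have e : (fun x => Real.smoothTransition ((ψ x - t) / τ)) =
      Real.smoothTransition ∘ fun x => (ψ x - t) * τ⁻¹ := by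
    ext x; simp [div_eq_mul_inv]
  rw [norm_gradient, e, h2, norm_smul, norm_smul, ← norm_gradient, Real.norm_eq_abs,
    Real.norm_of_nonneg (by positivity)]
  have hB0 : 0 ≤ B := (abs_nonneg _).trans (hB 0)
  calc _ ≤ B * (τ⁻¹ * M) := by
        have a1 := hB ((ψ x - t) * τ⁻¹)
        have a2 := hM x
        gcongr
    _ = _ := by ring

/-- The excess of `-u / d` over the level `t` in the superlevel set `{ψ > t}`. -/
def excess (σ : ℝ) (Ω : Set (E n)) (ψ u : E n → ℝ) (d t : ℝ) : ℝ≥0∞ :=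
  ∫⁻ x in Ω ∩ {x | t < ψ x}, ENNReal.ofReal ((max (-u x / d - t) 0) ^ σ)

/-- The gain of integrability is used at the intermediate level m = t + τ, with a cut-off that is 1
on {ψ ≥ t + τ}. Where -u/d > t + τ, the quantity 1 + y is at most (2/τ)(-u/d - t); where -u/d > t +
2τ, y exceeds τ and `le_profile` applies. -/
theorem IsRealSupersolution.excess_le {p q : ℝ} (hp : 1 < p) (hpq : p ≤ q) (hqn : q ≤ n)
    {Ω : Set (E n)} (hΩ : IsOpen Ω) {u : E n → ℝ} {Z : E n → E n}
    (hu : IsRealSupersolution p q Ω u Z) {ε : ℝ} (hε : 0 < ε) (hε1 : ε ≤ 1)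
    (hεσ : ε * n ≤ (1 + ε) * (q - 1)) {ψ : E n → ℝ} (hψ : IsTest Ω ψ) :
    ∃ C : ℝ, 0 < C ∧ ∀ d t τ : ℝ, 1 ≤ d → 0 ≤ t → 0 < τ → τ ≤ 1 →
      excess ((1 + ε) * (q - 1)) Ω ψ u d (t + 2 * τ) ≤
        (ENNReal.ofReal (C / τ ^ (q + (1 + ε) * (q - 1) + 2)) *
          excess ((1 + ε) * (q - 1)) Ω ψ u d t) ^ ((n : ℝ) / (n - 1)) := by
  have hq : 1 < q := hp.trans_le hpq
  have hn1 : (1 : ℝ) < n := hq.trans_le hqn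
  have hn0 : (0 : ℝ) < n := by linarith
  have hp'0 : 0 < (n : ℝ) / (n - 1) := div_pos hn0 (by linarith)
  set σ := (1 + ε) * (q - 1) with hσ
  have hσ0 : 0 < σ := mul_pos (by linarith) (by linarith)
  -- Chosen so that the Sobolev power n/(n-1) returns the exponent σ; ε n ≤ σ is then exactly the
  -- condition on κ in Young's inequality.
  set κ : ℝ := σ * ((n - 1) / n) with hκ
  have hκe : κ = σ - σ / n := by rw [hκ]; field_simp
  have hκp : κ * (n / (n - 1)) = σ := by
    rw [hκ]; field_simp [(by linarith : (n : ℝ) - 1 ≠ 0)]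
  have hεσ' : ε ≤ σ / n := by rw [le_div_iff₀ hn0]; exact hεσ
  have hκ0 : 0 ≤ κ := mul_nonneg hσ0.le (div_nonneg (by linarith) hn0.le)
  have hκσ : κ ≤ σ := by rw [hκe]; linarith
  have hκ1 : κ - 1 ≤ (1 + ε) * (q - 2) := by
    have : (1 + ε) * (q - 2) = σ - (1 + ε) := by rw [hσ]; ring
    rw [this, hκe]; linarith
  obtain ⟨C0, hC0, hmain⟩ := hu.lintegral_profile_le hp hpq hqn hΩ hε hε1 hκ1 hκ0 hκσ
  set p' : ℝ := (n : ℝ) / (n - 1)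
  obtain ⟨B, hB0, hB⟩ := exists_abs_deriv_smoothTransition_le
  obtain ⟨Mψ, hMψ⟩ := (show HasCompactSupport (gradient ψ) from
    HasCompactSupport.intro hψ.compact fun x hx =>
      hψ.gradient_eq_zero hx).exists_bound_of_continuous hψ.continuous_gradient
  set M1 : ℝ := max 1 (B * Mψ)
  have hM1 : 1 ≤ M1 := le_max_left _ _
  refine ⟨4 * C0 * M1 ^ q * 2 ^ σ, by positivity, fun d t τ hd ht hτ hτ1 => ?_⟩
  have hd0 : 0 < d := by linarith
  set η : E n → ℝ := fun x => Real.smoothTransition ((ψ x - t) / τ) with hη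
  have hηt : IsTest Ω η := hψ.smoothTransition ht hτ
  have hηM : ∀ x, ‖gradient η x‖ ≤ M1 / τ := fun x =>
    (hψ.norm_gradient_smoothTransition_le hτ hB hMψ x).trans
      (div_le_div_of_nonneg_right (le_max_right _ _) hτ.le)
  have hMτ : 1 ≤ M1 / τ := by rw [le_div_iff₀ hτ]; linarith
  have h := hmain d (t + τ) (M1 / τ) hd (by linarith) hMτ η hηt
    (fun x => Real.smoothTransition.nonneg _) (fun x => Real.smoothTransition.le_one _) hηM
  have hum := hu.measurable_fun
  have hψm : Measurable ψ := hψ.smooth.continuous.measurable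
  have hηm : Measurable η := hηt.smooth.continuous.measurable
  have hExm : ∀ t, Measurable fun x => ENNReal.ofReal ((max (-u x / d - t) 0) ^ σ) := fun t =>
    ((((hum.neg.div_const d).sub_const t).max measurable_const).pow_const σ).ennreal_ofReal
  have hup : ∫⁻ x in (Ω ∩ {x | 0 < -u x / d - (t + τ)}) ∩ {x | 0 < η x},
      ENNReal.ofReal ((1 + (-u x / d - (t + τ))) ^ σ) ≤
      ENNReal.ofReal ((2 / τ) ^ σ) * excess σ Ω ψ u d t := by
    rw [excess, ← lintegral_const_mul _ (hExm t)]
    refine (setLIntegral_mono' (((hΩ.measurableSet.inter (measurableSet_lt measurable_const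
      ((hum.neg.div_const d).sub_const _)))).inter (measurableSet_lt measurable_const hηm))
      fun x hx => ?_).trans (lintegral_mono_set ?_)
    · have h1 : 0 < -u x / d - (t + τ) := hx.1.2
      rw [← ENNReal.ofReal_mul (by positivity), max_eq_left (by linarith),
        ← Real.mul_rpow (by positivity) (by linarith)]
      refine ENNReal.ofReal_le_ofReal (Real.rpow_le_rpow (by linarith) ?_ hσ0.le)
      rw [div_mul_eq_mul_div, le_div_iff₀ hτ]
      nlinarith
    · intro x hx
      refine ⟨hx.1.1, ?_⟩
      by_contra hc
      have h2 : η x = 0 := Real.smoothTransition.zero_of_nonpos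
        (div_nonpos_of_nonpos_of_nonneg (by have := not_lt.1 (show ¬ t < ψ x from hc); linarith) hτ.le)
      exact absurd hx.2 (by simp [h2])
  have hlow : ENNReal.ofReal (τ ^ 2 / 4) ^ p' * excess σ Ω ψ u d (t + 2 * τ) ≤
      ∫⁻ x, ‖profile κ (-u x / d - (t + τ)) * η x ^ n‖ₑ ^ p' := by
    rw [excess, ← lintegral_const_mul _ (hExm _)]
    refine (setLIntegral_mono' (hΩ.measurableSet.inter (measurableSet_lt measurable_const hψm))
      fun x hx => ?_).trans (setLIntegral_le_lintegral _ _)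
    have hψx : t + 2 * τ < ψ x := hx.2
    have hη1 : η x = 1 := Real.smoothTransition.one_of_one_le (by
      rw [le_div_iff₀ hτ]; linarith)
    rw [hη1, one_pow, mul_one, Real.enorm_eq_ofReal_abs, abs_of_nonneg (profile_nonneg _ _)]
    rcases le_or_gt (-u x / d - (t + 2 * τ)) 0 with h0 | h0
    · rw [max_eq_right h0, Real.zero_rpow hσ0.ne']
      simp
    · rw [max_eq_left h0.le, ← hκp, Real.rpow_mul h0.le,
        ← ENNReal.ofReal_rpow_of_nonneg (by positivity) hp'0.le,
        ← ENNReal.mul_rpow_of_nonneg _ _ hp'0.le, ← ENNReal.ofReal_mul (by positivity)]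
      refine ENNReal.rpow_le_rpow (ENNReal.ofReal_le_ofReal ?_) hp'0.le
      refine le_trans ?_ (le_profile hκ0 hτ hτ1 (by linarith))
      gcongr
      linarith
  calc excess σ Ω ψ u d (t + 2 * τ)
      = ENNReal.ofReal (4 / τ ^ 2) ^ p' *
          (ENNReal.ofReal (τ ^ 2 / 4) ^ p' * excess σ Ω ψ u d (t + 2 * τ)) := by
        rw [← mul_assoc, ← ENNReal.mul_rpow_of_nonneg _ _ hp'0.le,
          ← ENNReal.ofReal_mul (by positivity)]
        have : 4 / τ ^ 2 * (τ ^ 2 / 4) = 1 := by field_simp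
        rw [this]; simp
    _ ≤ ENNReal.ofReal (4 / τ ^ 2) ^ p' * (ENNReal.ofReal (C0 * (M1 / τ) ^ q) *
          (ENNReal.ofReal ((2 / τ) ^ σ) * excess σ Ω ψ u d t)) ^ p' :=
        mul_le_mul_right (hlow.trans (h.trans (ENNReal.rpow_le_rpow
          (mul_le_mul_right hup _) hp'0.le))) _
    _ = _ := by
        rw [← ENNReal.mul_rpow_of_nonneg _ _ hp'0.le, ← mul_assoc, ← mul_assoc,
          ← ENNReal.ofReal_mul (by positivity), ← ENNReal.ofReal_mul (by positivity)]
        congr 3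
        rw [Real.div_rpow (by positivity) hτ.le, Real.div_rpow (by positivity) hτ.le,
          Real.rpow_add hτ, Real.rpow_add hτ, Real.rpow_two]
        field_simp

/-- Fast geometric convergence. -/
theorem exists_tendsto_zero_of_le_rpow {C b r : ℝ} (hC : 0 < C) (hb : 1 < b) (hr : 1 < r) :
    ∃ δ : ℝ, 0 < δ ∧ ∀ y : ℕ → ℝ≥0∞, y 0 ≤ ENNReal.ofReal δ →
      (∀ j, y (j + 1) ≤ (ENNReal.ofReal (C * b ^ j) * y j) ^ r) → Tendsto y atTop (𝓝 0) := by
  have hb0 : 0 < b := by linarith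
  have hr1 : 0 < r - 1 := by linarith
  -- The ansatz y j ≤ δ l^j reproduces itself when b^r l^(r-1) = 1 and C^r δ^(r-1) = l.
  set l : ℝ := b ^ (-(r / (r - 1))) with hl
  have hl0 : 0 < l := by positivity
  have hl1 : l < 1 := Real.rpow_lt_one_of_one_lt_of_neg hb (by
    have : 0 < r / (r - 1) := by positivity
    linarith)
  set δ : ℝ := (l / C ^ r) ^ (r - 1)⁻¹ with hδ
  have hδ0 : 0 < δ := by positivity
  have e1 : C ^ r * δ ^ (r - 1) = l := by
    rw [hδ, Real.rpow_inv_rpow (by positivity) hr1.ne']; field_simp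
  have e2 : b ^ r * l ^ (r - 1) = 1 := by
    rw [hl, ← Real.rpow_mul hb0.le, ← Real.rpow_add hb0]
    have : r + -(r / (r - 1)) * (r - 1) = 0 := by field_simp; ring
    rw [this, Real.rpow_zero]
  have e3 (x : ℝ) (hx : 0 < x) : x ^ r = x ^ (r - 1) * x := by
    rw [← Real.rpow_add_one hx.ne']; ring_nf
  refine ⟨δ, hδ0, fun y hy0 hy => ?_⟩
  have hbound : ∀ j, y j ≤ ENNReal.ofReal (δ * l ^ j) := by
    intro j
    induction j with
    | zero => simpa using hy0
    | succ j ih =>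
      refine (hy j).trans ?_
      refine (ENNReal.rpow_le_rpow (mul_le_mul_right ih _) (by linarith)).trans (le_of_eq ?_)
      rw [← ENNReal.ofReal_mul (by positivity),
        ENNReal.ofReal_rpow_of_nonneg (by positivity) (by linarith)]
      congr 1
      calc (C * b ^ j * (δ * l ^ j)) ^ r = C ^ r * (b ^ r) ^ j * (δ ^ r * (l ^ r) ^ j) := by
            rw [Real.mul_rpow (by positivity) (by positivity), Real.mul_rpow hC.le (by positivity),
              Real.mul_rpow hδ0.le (by positivity), ← Real.rpow_pow_comm hb0.le r j,
              ← Real.rpow_pow_comm hl0.le r j]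
        _ = (C ^ r * δ ^ (r - 1)) * (b ^ r * l ^ (r - 1)) ^ j * (δ * l ^ j) := by
            rw [e3 δ hδ0, e3 l hl0, mul_pow, mul_pow]; ring
        _ = δ * l ^ (j + 1) := by rw [e1, e2]; ring
  refine tendsto_of_tendsto_of_tendsto_of_le_of_le tendsto_const_nhds ?_ (fun j => zero_le)
    hbound
  have := (tendsto_pow_atTop_nhds_zero_of_lt_one hl0.le hl1).const_mul δ
  rw [mul_zero] at this
  simpa using ENNReal.tendsto_ofReal this

theorem exists_isTest_eq_one {Ω K : Set (E n)} (hΩ : IsOpen Ω) (hK : IsCompact K) (hKΩ : K ⊆ Ω) :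
    ∃ ψ : E n → ℝ, IsTest Ω ψ ∧ ∀ x ∈ K, ψ x = 1 := by
  obtain ⟨δ, hδ, hδΩ⟩ := hK.exists_cthickening_subset_open hΩ hKΩ
  obtain ⟨f, hf, -, hs, h1⟩ := exists_contMDiff_support_eq_eq_one_iff
    (modelWithCornersSelf ℝ (E n)) (n := ⊤)
    (Metric.isOpen_thickening (δ := δ) (E := K)) hK.isClosed (Metric.self_subset_thickening hδ K)
  have h : tsupport f ⊆ Metric.cthickening δ K := by
    rw [tsupport, hs]
    exact Metric.closure_thickening_subset_cthickening _ _
  exact ⟨f, ⟨hf.contDiff, hK.cthickening.of_isClosed_subset (isClosed_tsupport _) h,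
    h.trans hδΩ⟩, fun x hx => (h1 x).1 hx⟩

/-- Local boundedness from below of real valued supersolutions. -/
theorem IsRealSupersolution.exists_forall_ae_le {p q : ℝ} (hp : 1 < p) (hpq : p ≤ q) (hqn : q ≤ n)
    {Ω : Set (E n)} (hΩ : IsOpen Ω) {u : E n → ℝ} {Z : E n → E n}
    (hu : IsRealSupersolution p q Ω u Z) {ε : ℝ} (hε : 0 < ε) (hε1 : ε ≤ 1)
    (hεσ : ε * n ≤ (1 + ε) * (q - 1))
    (hint : ∀ K : Set (E n), IsCompact K → K ⊆ Ω →
      ∫⁻ x in K, ENNReal.ofReal (|u x| ^ ((1 + ε) * (q - 1))) < ⊤)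
    {K : Set (E n)} (hK : IsCompact K) (hKΩ : K ⊆ Ω) :
    ∃ c : ℝ, ∀ᵐ x ∂(volume.restrict K), c ≤ u x := by
  have hq : 1 < q := hp.trans_le hpq
  have hn1 : (1 : ℝ) < n := hq.trans_le hqn
  obtain ⟨ψ, hψ, hψK⟩ := exists_isTest_eq_one hΩ hK hKΩ
  obtain ⟨C, hC, hstep⟩ := hu.excess_le hp hpq hqn hΩ hε hε1 hεσ hψ
  have hp'1 : 1 < (n : ℝ) / (n - 1) := by rw [lt_div_iff₀ (by linarith)]; linarith
  set p' : ℝ := (n : ℝ) / (n - 1)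
  set σ := (1 + ε) * (q - 1)
  have hσ0 : 0 < σ := mul_pos (by linarith) (by linarith)
  set a : ℝ := q + σ + 2
  have ha : 0 < a := by positivity
  -- These constants are C / τ^a for the step τ = 2^(-(j+2)), which takes the level 1 - 2^(-j) to 1
  -- - 2^(-(j+1)).
  obtain ⟨δ, hδ, hiter⟩ := exists_tendsto_zero_of_le_rpow (C := C * 4 ^ a) (b := 2 ^ a) (r := p')
    (by positivity) (Real.one_lt_rpow (by norm_num) ha) hp'1
  set I := ∫⁻ x in tsupport ψ, ENNReal.ofReal (|u x| ^ σ) with hI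
  have hIfin : I < ⊤ := hint _ hψ.compact hψ.support
  -- Large enough that d^(-σ) I ≤ δ; δ does not depend on d because the step estimate is uniform in
  -- d ≥ 1.
  set d : ℝ := max 1 ((I.toReal / δ) ^ σ⁻¹) with hd
  have hd1 : 1 ≤ d := le_max_left _ _
  have hd0 : 0 < d := by linarith
  have hdσ : I.toReal ≤ δ * d ^ σ := by
    have h1 : I.toReal / δ ≤ d ^ σ := by
      calc I.toReal / δ = ((I.toReal / δ) ^ σ⁻¹) ^ σ :=
            (Real.rpow_inv_rpow (by positivity) hσ0.ne').symm
        _ ≤ d ^ σ := Real.rpow_le_rpow (by positivity) (le_max_right _ _) hσ0.le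
    rw [div_le_iff₀ hδ] at h1
    linarith
  have hum := hu.measurable_fun
  have hψm : Measurable ψ := hψ.smooth.continuous.measurable
  set y : ℕ → ℝ≥0∞ := fun j => excess σ Ω ψ u d (1 - (1 / 2) ^ j) with hy
  have hy0 : y 0 ≤ ENNReal.ofReal δ := by
    have e0 : y 0 = ∫⁻ x in Ω ∩ {x | 0 < ψ x}, ENNReal.ofReal ((max (-u x / d) 0) ^ σ) := by
      simp [hy, excess]
    rw [e0]
    calc _ ≤ ∫⁻ x in tsupport ψ, ENNReal.ofReal ((d ^ σ)⁻¹) * ENNReal.ofReal (|u x| ^ σ) := by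
          refine (lintegral_mono fun x => ?_).trans (lintegral_mono_set ?_)
          · rw [← ENNReal.ofReal_mul (by positivity)]
            refine ENNReal.ofReal_le_ofReal ?_
            rw [← Real.inv_rpow hd0.le, ← Real.mul_rpow (by positivity) (abs_nonneg _)]
            refine Real.rpow_le_rpow (le_max_right _ _) (max_le ?_ (by positivity)) hσ0.le
            rw [div_eq_inv_mul]
            gcongr
            exact neg_le_abs _
          · intro x hx
            exact subset_tsupport _ (ne_of_gt hx.2)
      _ = ENNReal.ofReal ((d ^ σ)⁻¹) * I :=
          lintegral_const_mul _ ((measurable_norm.comp hum).pow_const σ).ennreal_ofReal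
      _ = ENNReal.ofReal ((d ^ σ)⁻¹ * I.toReal) := by
          rw [ENNReal.ofReal_mul (by positivity), ENNReal.ofReal_toReal hIfin.ne]
      _ ≤ ENNReal.ofReal δ := by
          refine ENNReal.ofReal_le_ofReal ?_
          rw [inv_mul_le_iff₀ (by positivity)]
          linarith
  have hrec : ∀ j, y (j + 1) ≤ (ENNReal.ofReal (C * 4 ^ a * (2 ^ a) ^ j) * y j) ^ p' := by
    intro j
    have hpow : (0 : ℝ) < (1 / 2) ^ j := by positivity
    have hpow1 : (1 / 2 : ℝ) ^ j ≤ 1 := pow_le_one₀ (by norm_num) (by norm_num)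
    have h1 := hstep d (1 - (1 / 2) ^ j) ((1 / 2) ^ (j + 2)) hd1 (by linarith) (by positivity)
      (pow_le_one₀ (by norm_num) (by norm_num))
    have e1 : 1 - (1 / 2 : ℝ) ^ j + 2 * (1 / 2) ^ (j + 2) = 1 - (1 / 2) ^ (j + 1) := by ring
    have e2 : C / ((1 / 2 : ℝ) ^ (j + 2)) ^ a = C * 4 ^ a * (2 ^ a) ^ j := by
      have : (1 / 2 : ℝ) ^ (j + 2) = (4 * 2 ^ j)⁻¹ := by
        rw [one_div, inv_pow, pow_add]; norm_num; ring
      rw [this, Real.inv_rpow (by positivity), Real.mul_rpow (by positivity) (by positivity),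
        Real.rpow_pow_comm (by norm_num), div_inv_eq_mul]
      ring
    rw [e1, e2] at h1
    exact h1
  have hlim := hiter y hy0 hrec
  -- The excess at the limiting level 1 lies below every y j, so it vanishes.
  set W := ∫⁻ x in Ω ∩ {x | 1 ≤ ψ x}, ENNReal.ofReal ((max (-u x / d - 1) 0) ^ σ) with hW
  have hWm : Measurable fun x => ENNReal.ofReal ((max (-u x / d - 1) 0) ^ σ) :=
    ((((hum.neg.div_const d).sub_const 1).max measurable_const).pow_const σ).ennreal_ofReal
  have hWy : ∀ j, W ≤ y j := by
    intro j
    have hpow : (0 : ℝ) < (1 / 2) ^ j := by positivity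
    refine (lintegral_mono fun x => ?_).trans (lintegral_mono_set ?_)
    · refine ENNReal.ofReal_le_ofReal (Real.rpow_le_rpow (le_max_right _ _) ?_ hσ0.le)
      gcongr
      linarith
    · intro x hx
      exact ⟨hx.1, lt_of_lt_of_le (by linarith : 1 - (1 / 2 : ℝ) ^ j < 1) hx.2⟩
  have hW0 : W = 0 := le_antisymm (ge_of_tendsto' hlim hWy) zero_le
  rw [hW, lintegral_eq_zero_iff hWm] at hW0
  have hKsub : K ⊆ Ω ∩ {x | 1 ≤ ψ x} := fun x hx => ⟨hKΩ hx, (hψK x hx).ge⟩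
  refine ⟨-d, ?_⟩
  filter_upwards [ae_restrict_of_ae_restrict_of_subset hKsub hW0] with x hx
  by_contra hc
  have h1 : 0 < -u x / d - 1 := by
    rw [sub_pos, lt_div_iff₀ hd0]
    linarith [not_le.1 hc]
  have h2 : ENNReal.ofReal ((max (-u x / d - 1) 0) ^ σ) = 0 := hx
  rw [max_eq_left h1.le, ENNReal.ofReal_eq_zero] at h2
  exact absurd h2 (not_le.2 (by positivity))

/-! ### From local renormalized solutions to real valued supersolutions -/

theorem trunc_coe (k s : ℝ) : trunc k (s : EReal) = max (-k) (min k s) := by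
  rw [trunc, ← EReal.coe_strictMono.monotone.map_min, ← EReal.coe_strictMono.monotone.map_max,
    EReal.toReal_coe]

theorem ext_coe (h : ℝ → ℝ) (s : ℝ) : ext h (s : EReal) = h s := by
  simp [ext]

theorem MemLpLoc.congr {F : Type*} [NormedAddCommGroup F] {s : ℝ} {Ω : Set (E n)} {f g : E n → F}
    (hf : MemLpLoc s Ω f) (h : f =ᵐ[volume.restrict Ω] g) : MemLpLoc s Ω g := fun K hK hKΩ =>
  (hf K hK hKΩ).ae_eq (ae_restrict_of_ae_restrict_of_subset hKΩ h)

theorem IsWeakGradient.congr {Ω : Set (E n)} {f g : E n → ℝ} {F G : E n → E n}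
    (hf : IsWeakGradient Ω f F) (h : f =ᵐ[volume.restrict Ω] g)
    (h' : F =ᵐ[volume.restrict Ω] G) : IsWeakGradient Ω g G where
  locInt_fun := hf.locInt_fun.congr h
  locInt_grad := hf.locInt_grad.congr h'
  integral_eq φ hφ := by
    have e1 : ∫ x in Ω, g x • gradient φ x = ∫ x in Ω, f x • gradient φ x :=
      integral_congr_ae (by filter_upwards [h] with x hx; rw [hx])
    have e2 : ∫ x in Ω, φ x • G x = ∫ x in Ω, φ x • F x :=
      integral_congr_ae (by filter_upwards [h'] with x hx; rw [hx])
    rw [e1, e2]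
    exact hf.integral_eq φ hφ

/-- The limits must exist: otherwise `limUnder` is an arbitrary value, with no sign. -/
theorem ext_nonneg {h : ℝ → ℝ} (h0 : ∀ t, 0 ≤ h t) (ht : ∃ a, Tendsto h atTop (𝓝 a))
    (hb : ∃ a, Tendsto h atBot (𝓝 a)) (s : EReal) : 0 ≤ ext h s := by
  obtain ⟨a, ha⟩ := ht
  obtain ⟨b, hb⟩ := hb
  unfold ext
  split_ifs
  · rw [ha.limUnder_eq]; exact ge_of_tendsto' ha h0
  · rw [hb.limUnder_eq]; exact ge_of_tendsto' hb h0
  · exact h0 _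

/-- The case m = 1 of the integrability condition makes |u|^(q-1) finite a.e. on closed balls in Ω,
and q - 1 > 0. -/
theorem IsLocalRenormalizedSolution.ae_abs_lt_top {p q : ℝ} (hq : 1 < q) {Ω : Set (E n)}
    (hΩ : IsOpen Ω) {μ : Measure (E n)} {u : E n → EReal}
    (hu : IsLocalRenormalizedSolution p q Ω μ u) :
    ∀ᵐ x ∂(volume.restrict Ω), (u x).abs < ⊤ := by
  rw [ae_restrict_iff' hΩ.measurableSet, ae_iff]
  refine measure_null_of_locally_null _ fun x hx => ?_
  have hxΩ : x ∈ Ω := by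
    by_contra h
    exact hx fun h' => absurd h' h
  obtain ⟨r, hr, hrΩ⟩ := Metric.nhds_basis_closedBall.mem_iff.1 (hΩ.mem_nhds hxΩ)
  have hK : IsCompact (Metric.closedBall x r) := isCompact_closedBall x r
  have h1 := hu.integrable 1 le_rfl (by linarith) _ hK hrΩ
  simp only [ENNReal.rpow_one] at h1
  have hm : AEMeasurable u (volume.restrict (Metric.closedBall x r)) :=
    hu.measurable.mono_set hrΩ
  have habs : Measurable EReal.abs := EReal.measurable_of_measurable_real (by
    simp only [EReal.abs_def]
    exact measurable_norm.ennreal_ofReal)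
  have h2 := ae_lt_top' ((habs.comp_aemeasurable hm).pow_const (q - 1)) h1.ne
  rw [ae_restrict_iff' hK.measurableSet, ae_iff] at h2
  refine ⟨{y | ¬ (y ∈ Ω → (u y).abs < ⊤)} ∩ Metric.closedBall x r,
    inter_mem_nhdsWithin _ (Metric.closedBall_mem_nhds x hr), measure_mono_null ?_ h2⟩
  intro y hy hc
  have h3 := hc hy.2
  have h4 : (u y).abs = ⊤ := by
    by_contra h
    exact hy.1 fun _ => lt_top_iff_ne_top.2 h
  rw [Function.comp_apply, h4, ENNReal.top_rpow_of_pos (by linarith)] at h3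
  exact lt_irrefl _ h3

/-- A local renormalized solution is a.e. equal to a real valued supersolution. -/
theorem IsLocalRenormalizedSolution.exists_isRealSupersolution {p q : ℝ} (hq : 1 < q)
    {Ω : Set (E n)} (hΩ : IsOpen Ω) {μ : Measure (E n)} {u : E n → EReal}
    (hu : IsLocalRenormalizedSolution p q Ω μ u) :
    ∃ (v : E n → ℝ) (Z : E n → E n), (∀ᵐ x ∂(volume.restrict Ω), u x = v x) ∧
      IsRealSupersolution p q Ω v Z := by
  obtain ⟨Z, w, μ₀, μₛ, ⟨hZm, hZ⟩, -, -, -, heq⟩ := hu.equation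
  set v : E n → ℝ := fun x => (hu.measurable.mk u x).toReal with hv
  set Z' := hZm.mk Z
  have huv : ∀ᵐ x ∂(volume.restrict Ω), u x = v x := by
    filter_upwards [hu.measurable.ae_eq_mk, hu.ae_abs_lt_top hq hΩ] with x h1 h2
    simp only [hv]
    rw [← h1]
    refine (EReal.coe_toReal ?_ ?_).symm
    · intro h; rw [h] at h2; simp at h2
    · intro h; rw [h] at h2; simp at h2
  have hZZ : ∀ᵐ x ∂(volume.restrict Ω), Z x = Z' x := hZm.ae_eq_mk
  refine ⟨v, Z', huv, ⟨hu.measurable.measurable_mk.ereal_toReal, hZm.measurable_mk,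
    fun k hk => ?_, fun h hh h0 hat hab φ hφ hφ0 => ?_⟩⟩
  · refine (hZ k hk).congr ?_ ?_
    · filter_upwards [huv] with x hx
      rw [hx, trunc_coe]
    · filter_upwards [huv, hZZ] with x hx hzx
      have : (u x).abs < ENNReal.ofReal k ↔ |v x| < k := by
        rw [hx, EReal.abs_def, ENNReal.ofReal_lt_ofReal_iff hk]
      simp only [Set.indicator_apply, Set.mem_ofPred_eq, this, hzx]
  · obtain ⟨i1, i2, i3⟩ := heq h hh φ hφ
    have c1 : (fun x => (‖Z x‖ ^ p + ‖Z x‖ ^ q) * ext (deriv h) (u x) * φ x)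
        =ᵐ[volume.restrict Ω] fun x => (‖Z' x‖ ^ p + ‖Z' x‖ ^ q) * deriv h (v x) * φ x := by
      filter_upwards [huv, hZZ] with x hx hzx
      rw [hx, hzx, ext_coe]
    have c2 : (fun x => inner ℝ (flux p q (Z x)) (gradient φ x) * ext h (u x))
        =ᵐ[volume.restrict Ω] fun x => inner ℝ (flux p q (Z' x)) (gradient φ x) * h (v x) := by
      filter_upwards [huv, hZZ] with x hx hzx
      rw [hx, hzx, ext_coe]
    refine ⟨i1.congr c1, i2.congr c2, ?_⟩
    rw [← integral_congr_ae c1, ← integral_congr_ae c2, i3]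
    refine add_nonneg (integral_nonneg fun x => ?_)
      (mul_nonneg (ext_nonneg h0 hat hab _) (integral_nonneg fun x => hφ0 x))
    exact mul_nonneg (ext_nonneg h0 hat hab _) (hφ0 x)

end PQGrowth

end

theorem lemma3p4 (n : ℕ) (p q : ℝ) (hp : 1 < p) (hpq : p ≤ q) (hqn : q ≤ n)
    (Ω : Set (PQGrowth.E n)) (hΩ : IsOpen Ω) (hΩb : Bornology.IsBounded Ω)
    (μ : Measure (PQGrowth.E n)) [IsFiniteMeasure μ]
    (u : PQGrowth.E n → EReal)
    (hu : PQGrowth.IsLocalRenormalizedSolution p q Ω μ u) :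
    PQGrowth.LocallyEssBoundedBelow Ω u := by
  have hq : 1 < q := hp.trans_le hpq
  have hn0 : (0 : ℝ) < n := by linarith
  obtain ⟨v, Z, huv, hv⟩ := hu.exists_isRealSupersolution hq hΩ
  -- Small enough for ε n ≤ (1 + ε)(q - 1), and for m = 1 + ε to be admissible in the integrability
  -- condition, which makes |u|^((1+ε)(q-1)) locally integrable.
  set ε : ℝ := (q - 1) / n with hε
  have hεn : ε * n = q - 1 := div_mul_cancel₀ _ hn0.ne'
  have hε0 : 0 < ε := div_pos (by linarith) hn0
  have hε1 : ε ≤ 1 := by rw [hε, div_le_one hn0]; linarith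
  have hm : (1 + ε) * ((n : ℝ) - q) < n := by nlinarith
  have hint : ∀ K : Set (PQGrowth.E n), IsCompact K → K ⊆ Ω →
      ∫⁻ x in K, ENNReal.ofReal (|v x| ^ ((1 + ε) * (q - 1))) < ⊤ := by
    intro K hK hKΩ
    refine lt_of_eq_of_lt (lintegral_congr_ae ?_) (hu.integrable (1 + ε) (by linarith) hm K hK hKΩ)
    filter_upwards [ae_restrict_of_ae_restrict_of_subset hKΩ huv] with x hx
    rw [hx, EReal.abs_def, ← ENNReal.rpow_mul, mul_comm (q - 1),
      ENNReal.ofReal_rpow_of_nonneg (abs_nonneg _) (mul_nonneg (by linarith) (by linarith))]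
  intro K hK hKΩ
  obtain ⟨c, hc⟩ := hv.exists_forall_ae_le hp hpq hqn hΩ hε0 hε1 (by nlinarith) hint hK hKΩ
  refine ⟨c, ?_⟩
  filter_upwards [hc, ae_restrict_of_ae_restrict_of_subset hKΩ huv] with x h1 h2
  rw [h2]
  exact_mod_cast h1
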